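/- Let $q>2$ be a prime power, let $F=\mathrm{GF}(q^2)$, let $\omega$ be a primitive element of $F$, and write $\mathrm{tr}(x)=x+x^q$. Let $\mathrm{SU}(3,q)$ be the group of $3\times3$ matrices over $F$ of determinant $1$ that preserve the hermitian form on $F^3$ given in the basis $(e_1,v,f_1)$ by $e_1.f_1=f_1.e_1=v.v=1$, all other products of basis vectors being $0$. Put $$\nu(\alpha,\beta)=\begin{pmatrix}1&\alpha&\beta\\0&1&-\alpha^q\\0&0&1\end{pmatrix},\quad \Delta=\mathrm{diag}(\omega,\omega^{q-1},\omega^{-q}),\quad t=\begin{pmatrix}0&0&1\\0&-1&0\\1&0&0\end{pmatrix},\quad \zeta=-\omega^{(q^2+q)/2}.$$ Put $\xi=1/(1+\omega^{q-1})$ and $\tau=\nu(0,1)$ if $q$ is even, $\xi=-1/2$ and $\tau=\nu(0,\zeta)$ if $q$ is odd, and let $\nu=\nu(1,\xi)$. Let $H=\langle\nu,\tau,\Delta\rangle$. Then $H$ is the Borel subgroup of upper triangular matrices in $\mathrm{SU}(3,q)$. For $u=\nu(\alpha,\beta)$ with $\beta\neq0$ and $\mathrm{tr}(\beta)=-\alpha^{q+1}$,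 let $P(u)$ be the relation $t^{-1}ut=u_L\,d\,t\,u_R$, where $u_L=\nu(-\alpha\beta^{-q},\beta^{-1})$, $d=\mathrm{diag}(\beta^{-q},\beta^{q-1},\beta)$ and $u_R=\nu(-\alpha\beta^{-1},\beta^{-1})$, the elements $u,u_L,d,u_R$ of $H$ being written as words in $\nu,\tau,\Delta$ (in any way). Let $\beta_0=\omega\zeta$ or $\beta_0=\omega^{1+(q^2+q)/2}$. There exists $\gamma_0\in F$ with $\mathrm{tr}(\gamma_0)=0$ and $\beta_0+\gamma_0\in \mathrm{GF}(q)^\times\omega^{-1}\zeta$; fix such a $\gamma_0$ and put $\tau_0=\nu(0,\gamma_0)$. (a) If $q\not\equiv2\bmod3$, there exists $\alpha_0\in F$ with $\alpha_0^{q+1}=-\mathrm{tr}(\beta_0)$. For any such $\alpha_0$, put $\nu_0=\nu(\alpha_0,\beta_0)$ and $U_0=\{\nu_0,\ \tau_0,\ \nu_0\tau_0\}$, a set of $3$ elements. (b) If $q\equiv2\bmod3$, there exist $\alpha_0,\alpha_1,\alpha_2$ with $\alpha_i\in\omega^i(F^\times)^3$ and $\alpha_i^{q+1}=-\mathrm{tr}(\beta_0)$.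 For any such $\alpha_i$, put $\nu_i=\nu(\alpha_i,\beta_0)$ and $U_0=\{\nu_i,\ \tau_0,\ \nu_i\tau_0 : 0\le i\le2\}$, a set of $7$ elements. In both cases, let $R(1)$ be any set of relations in $\nu,\tau,\Delta$ which, together with $\Delta^{q^2-1}=1$, presents $H$ on the generators $\nu,\tau,\Delta$ (so the relation $\Delta^{q^2-1}=1$ may, but need not, be omitted from a presentation of $H$). Then $$\{\nu,\tau,\Delta,t\mid R(1),\ P(u)\ (u\in U_0),\ \Delta^t=\Delta^{-q},\ t^2=1\}$$ is a presentation of $\mathrm{SU}(3,q)$: the presented group is isomorphic to $\mathrm{SU}(3,q)$ by an isomorphism that sends each generator to the matrix of the same name. -/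

import Mathlib

noncomputable section

/-- `SL(3, F)`, in which all matrix groups below live. -/
abbrev SL3 (F : Type*) [Field F] : Type _ := Matrix.SpecialLinearGroup (Fin 3) F

/-- `R` is a set of defining relators, on the generators `x i`, for the subgroup `K` of `G`:
the group presented by `R` is isomorphic to `K` by an isomorphism that sends the `i`-th
abstract generator to `x i`. -/
def Presents {X G : Type*} [Group G] (x : X → G) (R : Set (FreeGroup X)) (K : Subgroup G) :
    Prop :=
  ∃ φ : PresentedGroup R ≃* K, ∀ i, (φ (PresentedGroup.of i) : G) = x i

section Matrices

variable {F : Type*} [Field F]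

/-- The hermitian form on row vectors with respect to the basis `(e₁, v, f₁)`:
`e₁.f₁ = f₁.e₁ = v.v = 1`, and the form vanishes on all other pairs of basis vectors.
(For `|F| = q²`, the map `x ↦ x ^ q` is the involutory automorphism of `F`.) -/
def hermForm (q : ℕ) (x y : Fin 3 → F) : F :=
  x 0 * y 2 ^ q + x 1 * y 1 ^ q + x 2 * y 0 ^ q

/-- `SU(3, q)`: the matrices of determinant `1` that preserve the hermitian form. -/
def SU3 (F : Type*) [Field F] (q : ℕ) : Subgroup (SL3 F) where
  carrier := {A | ∀ x y : Fin 3 → F,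
    hermForm q (Matrix.vecMul x A.1) (Matrix.vecMul y A.1) = hermForm q x y}
  one_mem' := by
    intro x y
    simp
  mul_mem' := by
    intro A B hA hB x y
    have h := hB (Matrix.vecMul x A.1) (Matrix.vecMul y A.1)
    rw [Matrix.vecMul_vecMul, Matrix.vecMul_vecMul] at h
    exact h.trans (hA x y)
  inv_mem' := by
    intro A hA x y
    have h := hA (Matrix.vecMul x (A⁻¹).1) (Matrix.vecMul y (A⁻¹).1)
    have e : (A⁻¹).1 * A.1 = 1 := congrArg Subtype.val (inv_mul_cancel A)
    rw [Matrix.vecMul_vecMul, Matrix.vecMul_vecMul, e, Matrix.vecMul_one, Matrix.vecMul_one] at h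
    exact h.symm

/-- The unitriangular matrix `ν(α, β)`. It lies in `SU(3, q)` if `tr β = - α ^ (q + 1)`. -/
def nuMat (q : ℕ) (α β : F) : SL3 F :=
  ⟨!![1, α, β; 0, 1, -α ^ q; 0, 0, 1], by simp [Matrix.det_fin_three]⟩

/-- The diagonal matrix `Δ(α) = diag(α, α ^ (q - 1), α ^ (-q))`. -/
def deltaMat (q : ℕ) (α : Fˣ) : SL3 F :=
  ⟨!![(α : F), 0, 0; 0, ((α ^ ((q : ℤ) - 1) : Fˣ) : F), 0; 0, 0, ((α ^ (-(q : ℤ)) : Fˣ) : F)], by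
    simp only [Matrix.det_fin_three, Matrix.of_apply, Matrix.cons_val', Matrix.cons_val_zero,
      Matrix.cons_val_one, Matrix.cons_val, mul_zero, zero_mul, sub_zero, add_zero]
    rw [← Units.val_mul, ← Units.val_mul, ← zpow_one_add, ← zpow_add]
    simp⟩

/-- The matrix `t`. -/
def tMat (F : Type*) [Field F] : SL3 F :=
  ⟨!![0, 0, 1; 0, -1, 0; 1, 0, 0], by simp [Matrix.det_fin_three]⟩

/-- The trace from `GF(q²)` to `GF(q)`. -/
def trq (q : ℕ) (x : F) : F := x + x ^ q

/-- `ξ`, an element of trace `-1`. -/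
def xiElt (q : ℕ) (ω : Fˣ) : F :=
  if Even q then 1 / (1 + (ω : F) ^ (q - 1)) else -1 / 2

/-- `ζ`, an element of trace `0`. -/
def zetaElt (q : ℕ) (ω : Fˣ) : F := -(ω : F) ^ ((q ^ 2 + q) / 2)

/-- The generator `ν = ν(1, ξ)`. -/
def nuGen (q : ℕ) (ω : Fˣ) : SL3 F := nuMat q 1 (xiElt q ω)

/-- The generator `τ`, that is `ν(0, ζ)` for odd `q` and `ν(0, 1)` for even `q`. -/
def tauGen (q : ℕ) (ω : Fˣ) : SL3 F :=
  if Even q then nuMat q 0 1 else nuMat q 0 (zetaElt q ω)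

/-- The generators `ν, τ, Δ` of the Borel subgroup `H`. -/
def borelGens (q : ℕ) (ω : Fˣ) : Fin 3 → SL3 F :=
  ![nuGen q ω, tauGen q ω, deltaMat q ω]

/-- The Borel subgroup `H = ⟨ν, τ, Δ⟩`. -/
def borelH (q : ℕ) (ω : Fˣ) : Subgroup (SL3 F) :=
  Subgroup.closure {nuGen q ω, tauGen q ω, deltaMat q ω}

/-- The generators `ν, τ, Δ, t` of `SU(3, q)`. -/
def su3Gens (q : ℕ) (ω : Fˣ) : Fin 4 → SL3 F :=
  ![nuGen q ω, tauGen q ω, deltaMat q ω, tMat F]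

/-- A word in `ν, τ, Δ` read as a word in `ν, τ, Δ, t`. -/
def inclWord : FreeGroup (Fin 3) →* FreeGroup (Fin 4) := FreeGroup.map Fin.castSucc

/-- The generator `Δ` as a word in `ν, τ, Δ`. -/
def wDelta : FreeGroup (Fin 3) := FreeGroup.of 2

/-- The generator `t` as a word in `ν, τ, Δ, t`. -/
def wT : FreeGroup (Fin 4) := FreeGroup.of 3

/-- The element of `H` to which a word in `ν, τ, Δ` evaluates. -/
def evalH (q : ℕ) (ω : Fˣ) : FreeGroup (Fin 3) →* SL3 F := FreeGroup.lift (borelGens q ω)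

/-- The word `r` is a relator for the relation `P(u) : u ^ t = u_L d t u_R`, where
`u = ν(α, β)`, `β ≠ 0`, and `u_L = ν(-α β^(-q), β⁻¹)`, `d = diag(β^(-q), β^(q-1), β)`,
`u_R = ν(-α β⁻¹, β⁻¹)`; the elements `u, u_L, d, u_R` of `H` are written as arbitrary words
in `ν, τ, Δ`, and `u ^ t = t⁻¹ u t`. -/
def IsRelatorP (q : ℕ) (ω : Fˣ) (u : SL3 F) (r : FreeGroup (Fin 4)) : Prop :=
  ∃ (α : F) (β : Fˣ) (w wL wd wR : FreeGroup (Fin 3)),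
    u = nuMat q α β ∧
    evalH q ω w = u ∧
    evalH q ω wL = nuMat q (-α * ((β ^ (-(q : ℤ)) : Fˣ) : F)) ((β⁻¹ : Fˣ) : F) ∧
    (evalH q ω wd).1 = Matrix.diagonal
      ![((β ^ (-(q : ℤ)) : Fˣ) : F), ((β ^ ((q : ℤ) - 1) : Fˣ) : F), (β : F)] ∧
    evalH q ω wR = nuMat q (-α * ((β⁻¹ : Fˣ) : F)) ((β⁻¹ : Fˣ) : F) ∧
    r = (wT⁻¹ * inclWord w * wT) * (inclWord wL * inclWord wd * wT * inclWord wR)⁻¹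

/-- The relators on `ν, τ, Δ, t`: those of `R₁` (words in `ν, τ, Δ`), those of `R₂`,
and the relations `Δ ^ t = Δ ^ (-q)` and `t² = 1`. -/
def su3Relators (q : ℕ) (R₁ : Set (FreeGroup (Fin 3))) (R₂ : Set (FreeGroup (Fin 4))) :
    Set (FreeGroup (Fin 4)) :=
  (inclWord '' R₁) ∪ R₂ ∪
    {(wT⁻¹ * inclWord wDelta * wT) * (inclWord wDelta ^ (-(q : ℤ)))⁻¹, wT ^ 2}

/-- For words `P u`, each of which expresses the relation `P(u)` for the corresponding
`u ∈ U₀`, and for each set `R₁` of words in `ν, τ, Δ` that becomes a set of defining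
relators for `H` when `Δ ^ (q² - 1)` is adjoined (as it does if it already is one), the
relations of `R₁`, the relations `P(u)` for `u ∈ U₀`, and `Δ ^ t = Δ ^ (-q)`, `t² = 1`
define `SU(3, q)`. -/
def Completes (q : ℕ) (ω : Fˣ) (U₀ : Set (SL3 F)) : Prop :=
  ∀ (R₁ : Set (FreeGroup (Fin 3))) (P : SL3 F → FreeGroup (Fin 4)),
    Presents (borelGens q ω) (R₁ ∪ {wDelta ^ (q ^ 2 - 1)}) (borelH q ω) →
    (∀ u ∈ U₀, IsRelatorP q ω u (P u)) →
    Presents (su3Gens q ω) (su3Relators q R₁ (P '' U₀)) (SU3 F q)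

end Matrices

end

/-! Let Γ be the presented group. Conjugating Δ twice by t gives Δ = Δ^(q²), so Δ^(q²-1) = 1 already
holds in Γ (`pow_eq_one_of_conj`), and H maps to Γ. If P(u) holds in Γ for every u = ν(a, b) with b
≠ 0, then H ∪ HtH is stable under right multiplication by H and t, hence is all of Γ
(`bruhat_induction`). The map from Γ to the matrices is the identity on H and sends HtH to matrices
outside H, because t is not upper triangular. So it is injective, and its image is SU(3, q) because
an isotropic last row can be moved by some ν(a, b)t to make the matrix upper triangular
(`closure_su3Gens`, `completes_of_pRel`).

It remains to deduce every P(u) from those with u in U₀, for which two moves suffice. Conjugation by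
Δ(l) carries P(a, b) to P(a l^(q-2), b l^(-q-1)) (`PRel.conj`). Factoring ν(a, b + c) = ν(a, b) ν(0,
c) with tr c = 0 gives P(a, b + c) from P(a, b), P(0, c) and P(-a/b, d), where d = (b + c)/(bc)
(`PRel.mul`).

Sort the b by class modulo GF(q)^×, represented by ω^k ζ with 0 ≤ k ≤ q. Class 0 is the trace-zero
case a = 0; norms fill GF(q)^×, so one conjugacy class covers it and P(τ₀) suffices
(`PRel.central`). In class 1 the value of a determines b, so P at the ν(α_i, β₀) suffices as soon as
the α_i meet every coset of the (q-2)-th powers (`PRel.conj_of_div`). These powers are all of F^× if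
q ≢ 2 mod 3 and contain the cubes in any case. For b in class k + 1, take the first factor in class
1 with the same trace as b; then d lies in class k, and induction reaches every class
(`pRel_class`). -/

/-! ### The involution x ↦ x^q. -/

/-- `x ↦ x ^ q` is an involutory field automorphism of `F`. -/
structure QuadConj (F : Type*) [Field F] (q : ℕ) : Prop where
  two_lt : 2 < q
  add : ∀ x y : F, (x + y) ^ q = x ^ q + y ^ q
  pp : ∀ x : F, (x ^ q) ^ q = x

namespace QuadConj

variable {F : Type*} [Field F] {q : ℕ}

theorem zero (h : QuadConj F q) : (0 : F) ^ q = 0 := zero_pow (by have := h.two_lt; omega)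

theorem neg (h : QuadConj F q) (x : F) : (-x) ^ q = -x ^ q := by
  have := h.add x (-x)
  rw [add_neg_cancel, h.zero] at this
  exact eq_neg_of_add_eq_zero_right this.symm

theorem sub (h : QuadConj F q) (x y : F) : (x - y) ^ q = x ^ q - y ^ q := by
  rw [sub_eq_add_neg, h.add, h.neg, sub_eq_add_neg]

end QuadConj

theorem prime_pow_of_card {F : Type*} [Field F] [Finite F] {q : ℕ}
    (hF : Nat.card F = q ^ 2) :
    ∃ p k : ℕ, p.Prime ∧ CharP F p ∧ q = p ^ k := by
  have := Fintype.ofFinite F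
  obtain ⟨p, hp⟩ := CharP.exists F
  obtain ⟨n, hpp, hn⟩ := FiniteField.card F p
  rw [← Nat.card_eq_fintype_card, hF] at hn
  obtain ⟨k, -, hk⟩ := (Nat.dvd_prime_pow hpp).1 (hn ▸ dvd_pow_self q two_ne_zero)
  exact ⟨p, k, hpp, hp, hk⟩

theorem quadConj_of_card {F : Type*} [Field F] [Finite F] {q : ℕ} (hq : 2 < q)
    (hF : Nat.card F = q ^ 2) : QuadConj F q := by
  have := Fintype.ofFinite F
  obtain ⟨p, k, hp, hc, rfl⟩ := prime_pow_of_card hF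
  have := Fact.mk hp
  refine ⟨hq, fun x y => add_pow_char_pow x y p k, fun x => ?_⟩
  rw [← pow_mul, ← sq, ← hF, Nat.card_eq_fintype_card, FiniteField.pow_card]

/-! ### Matrix identities for ν(a, b), Δ(l) and t. -/

section Mat

variable {F : Type*} [Field F] {q : ℕ}

theorem nuMat_mem_SU3 (h : QuadConj F q) {a b : F} (hab : b + b ^ q = -(a * a ^ q)) :
    nuMat q a b ∈ SU3 F q := by
  intro x y
  simp only [hermForm, nuMat, Matrix.vecMul, dotProduct, Fin.sum_univ_three, Matrix.of_apply,
    Matrix.cons_val', Matrix.cons_val_zero, Matrix.cons_val_one, Matrix.cons_val, h.add, mul_pow,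
    h.neg, h.pp, h.zero, one_pow]
  linear_combination (x 0 * y 0 ^ q) * hab

theorem nuMat_mul (h : QuadConj F q) (a b c d : F) :
    nuMat q a b * nuMat q c d = nuMat q (a + c) (b + d - a * c ^ q) := by
  apply Subtype.ext
  rw [Matrix.SpecialLinearGroup.coe_mul]
  ext i j
  fin_cases i <;> fin_cases j <;>
    simp [nuMat, Matrix.mul_apply, Fin.sum_univ_three, h.add] <;> ring

theorem nuMat_zero (h : QuadConj F q) : nuMat q (0 : F) 0 = 1 := by
  ext i j
  fin_cases i <;> fin_cases j <;> simp [nuMat, h.zero]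

theorem nuMat_inj {a b c d : F} (e : nuMat q a b = nuMat q c d) : a = c ∧ b = d := by
  have e1 := congrArg (fun A : SL3 F => A.1 0 1) e
  have e2 := congrArg (fun A : SL3 F => A.1 0 2) e
  simpa [nuMat] using And.intro e1 e2

theorem deltaMat_val (l : Fˣ) : (deltaMat q l).1 =
    !![(l : F), 0, 0; 0, (l : F) ^ q / l, 0; 0, 0, ((l : F) ^ q)⁻¹] := by
  simp [deltaMat, zpow_sub₀, zpow_neg]

/-- `deltaMat` as a homomorphism. -/
def deltaHom (F : Type*) [Field F] (q : ℕ) : Fˣ →* SL3 F where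
  toFun := deltaMat q
  map_one' := by
    apply Subtype.ext
    rw [deltaMat_val]
    ext i j
    fin_cases i <;> fin_cases j <;> simp
  map_mul' l m := by
    apply Subtype.ext
    rw [Matrix.SpecialLinearGroup.coe_mul, deltaMat_val, deltaMat_val, deltaMat_val]
    ext i j
    fin_cases i <;> fin_cases j <;> simp [Matrix.mul_apply, Fin.sum_univ_three, mul_pow] <;> ring

theorem deltaHom_val (l : Fˣ) : (deltaHom F q l).1 =
    !![(l : F), 0, 0; 0, (l : F) ^ q / l, 0; 0, 0, ((l : F) ^ q)⁻¹] := deltaMat_val l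

theorem deltaHom_mem_SU3 (h : QuadConj F q) (l : Fˣ) : deltaHom F q l ∈ SU3 F q := by
  intro x y
  have hl : (l : F) ≠ 0 := l.ne_zero
  simp only [hermForm, deltaHom_val, Matrix.vecMul, dotProduct, Fin.sum_univ_three,
    Matrix.of_apply, Matrix.cons_val', Matrix.cons_val_zero, Matrix.cons_val_one, Matrix.cons_val,
    h.add, mul_pow, h.pp, h.zero, inv_pow, div_pow]
  have hL : (l : F) ^ q ≠ 0 := pow_ne_zero q hl
  generalize (l : F) ^ q = L at hL ⊢
  field_simp
  ring

theorem nuMat_conj (h : QuadConj F q) (a b : F) (l : Fˣ) :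
    (deltaHom F q l)⁻¹ * nuMat q a b * deltaHom F q l =
      nuMat q (a * (l : F) ^ q / (l : F) ^ 2) (b / (l * (l : F) ^ q)) := by
  have hl : (l : F) ≠ 0 := l.ne_zero
  rw [mul_assoc, inv_mul_eq_iff_eq_mul]
  apply Subtype.ext
  rw [Matrix.SpecialLinearGroup.coe_mul, Matrix.SpecialLinearGroup.coe_mul, deltaHom_val]
  ext i j
  fin_cases i <;> fin_cases j <;>
    simp [nuMat, Matrix.mul_apply, Fin.sum_univ_three, mul_pow, h.pp, div_pow, pow_right_comm _ 2 q]
  all_goals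
    have hL : (l : F) ^ q ≠ 0 := pow_ne_zero q hl
    generalize (l : F) ^ q = L at hL ⊢
    field_simp

theorem tMat_mul_self : tMat F * tMat F = 1 := by
  apply Subtype.ext
  rw [Matrix.SpecialLinearGroup.coe_mul]
  ext i j
  fin_cases i <;> fin_cases j <;> simp [tMat, Matrix.mul_apply, Fin.sum_univ_three]

theorem tMat_inv : (tMat F)⁻¹ = tMat F := inv_eq_of_mul_eq_one_left tMat_mul_self

theorem tMat_mem_SU3 (h : QuadConj F q) : tMat F ∈ SU3 F q := by
  intro x y
  simp only [hermForm, tMat, Matrix.vecMul, dotProduct, Fin.sum_univ_three, Matrix.of_apply,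
    Matrix.cons_val', Matrix.cons_val_zero, Matrix.cons_val_one, Matrix.cons_val, h.add, mul_pow,
    h.neg, h.zero, one_pow]
  ring

theorem tMat_conj_delta (h : QuadConj F q) (l : Fˣ) :
    tMat F * deltaHom F q l * tMat F = deltaHom F q (l ^ q)⁻¹ := by
  have hl : (l : F) ≠ 0 := l.ne_zero
  apply Subtype.ext
  simp only [Matrix.SpecialLinearGroup.coe_mul, deltaHom_val]
  ext i j
  fin_cases i <;> fin_cases j <;>
    simp [tMat, Matrix.mul_apply, Fin.sum_univ_three, h.pp]
  field_simp

/-- This is P(u) for matrices, so the relators P(u) die in SU(3, q). -/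
theorem tMat_conj_nu (h : QuadConj F q) {a : F} {b : Fˣ} (hab : (b : F) + b ^ q = -(a * a ^ q)) :
    tMat F * nuMat q a b * tMat F =
      nuMat q (-(a / (b : F) ^ q)) (b : F)⁻¹ * deltaHom F q (b ^ q)⁻¹ * tMat F *
        nuMat q (-(a / b)) (b : F)⁻¹ := by
  have hb : (b : F) ≠ 0 := b.ne_zero
  apply Subtype.ext
  simp only [Matrix.SpecialLinearGroup.coe_mul, deltaHom_val]
  ext i j
  fin_cases i <;> fin_cases j <;>
    simp [nuMat, tMat, Matrix.mul_apply, Fin.sum_univ_three, h.pp, h.neg, div_pow]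
  all_goals
    have hB : (b : F) ^ q ≠ 0 := pow_ne_zero q hb
    generalize (b : F) ^ q = B at hB hab ⊢
    generalize a ^ q = A at hab ⊢
    field_simp
  all_goals first | ring1 | linear_combination hab | linear_combination -hab

end Mat

/-! ### The relations P(u) in an abstract group: conjugation and composition. -/

/-- The condition for `ν(a, b)` to lie in `SU(3, q)`. -/
def TraceCond {F : Type*} [Field F] (q : ℕ) (a b : F) : Prop := b + b ^ q = -(a * a ^ q)

section Rules

variable {F : Type*} [Field F] {q : ℕ} {Γ : Type*} [Group Γ]

/-- Elements `N a b`, `D l`, `T` of a group that multiply like `ν(a, b)`, `Δ(l)`, `t`,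
except that no relation for the conjugates `N a b ^ T` is assumed. -/
structure BorelRules (q : ℕ) (N : F → F → Γ) (D : Fˣ →* Γ) (T : Γ) : Prop where
  mul : ∀ a b c d : F, TraceCond q a b → TraceCond q c d →
    N a b * N c d = N (a + c) (b + d - a * c ^ q)
  conj : ∀ (a b : F) (l : Fˣ), TraceCond q a b →
    (D l)⁻¹ * N a b * D l = N (a * (l : F) ^ q / (l : F) ^ 2) (b / (l * (l : F) ^ q))
  TT : T * T = 1
  TD : ∀ l : Fˣ, T * D l * T = D (l ^ q)⁻¹

/-- The relation `P(u)` for `u = ν(a, b)`. -/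
def PRel (q : ℕ) (N : F → F → Γ) (D : Fˣ →* Γ) (T : Γ) (a : F) (b : Fˣ) : Prop :=
  T * N a b * T =
    N (-(a / (b : F) ^ q)) (b : F)⁻¹ * D (b ^ q)⁻¹ * T * N (-(a / b)) (b : F)⁻¹

theorem TraceCond.left (h : QuadConj F q) {a : F} {b : Fˣ} (H : TraceCond q a (b : F)) :
    TraceCond q (-(a / (b : F) ^ q)) (b : F)⁻¹ := by
  have hb : (b : F) ≠ 0 := b.ne_zero
  have hB : (b : F) ^ q ≠ 0 := pow_ne_zero q hb
  unfold TraceCond at *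
  rw [h.neg, div_pow, h.pp, inv_pow]
  generalize (b : F) ^ q = B at hB H ⊢
  generalize a ^ q = A at H ⊢
  field_simp
  linear_combination H

theorem TraceCond.right (h : QuadConj F q) {a : F} {b : Fˣ} (H : TraceCond q a (b : F)) :
    TraceCond q (-(a / (b : F))) (b : F)⁻¹ := by
  have hb : (b : F) ≠ 0 := b.ne_zero
  have hB : (b : F) ^ q ≠ 0 := pow_ne_zero q hb
  unfold TraceCond at *
  rw [h.neg, div_pow, inv_pow]
  generalize (b : F) ^ q = B at hB H ⊢
  generalize a ^ q = A at H ⊢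
  field_simp
  linear_combination H

theorem TraceCond.conj (h : QuadConj F q) {a b : F} (H : TraceCond q a b) (l : Fˣ) :
    TraceCond q (a * (l : F) ^ q / (l : F) ^ 2) (b / (l * (l : F) ^ q)) := by
  have hb : (l : F) ≠ 0 := l.ne_zero
  have hB : (l : F) ^ q ≠ 0 := pow_ne_zero q hb
  unfold TraceCond at *
  simp only [div_pow, mul_pow, h.pp, pow_right_comm _ 2 q]
  generalize (l : F) ^ q = B at hB H ⊢
  generalize a ^ q = A at H ⊢
  field_simp
  linear_combination H

theorem TraceCond.mul (h : QuadConj F q) {a b c d : F} (H : TraceCond q a b)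
    (H' : TraceCond q c d) : TraceCond q (a + c) (b + d - a * c ^ q) := by
  unfold TraceCond at *
  simp only [h.add, h.sub, mul_pow, h.pp]
  linear_combination H + H'

variable {N : F → F → Γ} {D : Fˣ →* Γ} {T : Γ}

theorem BorelRules.T_mul_D (R : BorelRules q N D T) (l : Fˣ) :
    T * D l = D (l ^ q)⁻¹ * T := by
  rw [← R.TD l, mul_assoc _ T T, R.TT, mul_one]

theorem BorelRules.N_mul_D (R : BorelRules q N D T) {a b : F} (H : TraceCond q a b) (l : Fˣ) :
    N a b * D l = D l * N (a * (l : F) ^ q / (l : F) ^ 2) (b / (l * (l : F) ^ q)) := by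
  rw [← R.conj a b l H]
  group

theorem QuadConj.unit_pp (h : QuadConj F q) (l : Fˣ) : (l ^ q) ^ q = l :=
  Units.ext (by push_cast; exact h.pp _)

/-- Since T inverts and q-twists the torus, conjugating P(u) by D(l^(-q)) turns T u T into T
u^(D(l)) T; on the other side the unipotent factors are conjugated by D(l^(-q)) and the torus factor
absorbs the rest. -/
theorem PRel.conj (h : QuadConj F q) (R : BorelRules q N D T) {a : F} {b : Fˣ}
    (H : TraceCond q a (b : F)) (E : PRel q N D T a b) (l : Fˣ) :
    PRel q N D T (a * (l : F) ^ q / (l : F) ^ 2) (b / (l * l ^ q)) := by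
  have hb : (b : F) ≠ 0 := b.ne_zero
  have hB : (b : F) ^ q ≠ 0 := pow_ne_zero q hb
  have hl : (l : F) ≠ 0 := l.ne_zero
  have hL : (l : F) ^ q ≠ 0 := pow_ne_zero q hl
  have e1 := R.conj _ _ (l ^ q)⁻¹ (H.left h)
  have e2 := R.conj _ _ (l ^ q)⁻¹ (H.right h)
  have f1 : T * N (a * (l : F) ^ q / (l : F) ^ 2) (b / (l * (l : F) ^ q)) * T =
      (D (l ^ q)⁻¹)⁻¹ * (T * N a b * T) * D (l ^ q)⁻¹ := by
    rw [← R.conj _ _ l H, ← R.TD, mul_inv_rev, mul_inv_rev, inv_eq_of_mul_eq_one_right R.TT]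
    simp only [mul_assoc]
    rw [← mul_assoc T T, R.TT, one_mul, ← mul_assoc T T, R.TT, one_mul]
  have f2 : T * D (l ^ q)⁻¹ = D l * T := by
    rw [R.T_mul_D, inv_pow, h.unit_pp, inv_inv]
  unfold PRel at *
  have f3 : ((b / (l * l ^ q) : Fˣ) : F) = b / (l * (l : F) ^ q) := by push_cast; rfl
  rw [f3, f1, E]
  calc _ = ((D (l ^ q)⁻¹)⁻¹ * N (-(a / (b : F) ^ q)) (b : F)⁻¹ * D (l ^ q)⁻¹) *
        ((D (l ^ q)⁻¹)⁻¹ * D (b ^ q)⁻¹ * (T * D (l ^ q)⁻¹)) *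
        ((D (l ^ q)⁻¹)⁻¹ * N (-(a / b)) (b : F)⁻¹ * D (l ^ q)⁻¹) := by group
    _ = _ := by
      rw [e1, e2, f2]
      have f4 : (D (l ^ q)⁻¹)⁻¹ * D (b ^ q)⁻¹ * (D l * T) = D ((b / (l * l ^ q)) ^ q)⁻¹ * T := by
        rw [← map_inv, ← mul_assoc, ← map_mul, ← map_mul]
        congr 2
        rw [div_pow, mul_pow, h.unit_pp, inv_inv, inv_div, div_eq_mul_inv, mul_right_comm]
      rw [f4, ← mul_assoc]
      congr 3
      · push_cast
        simp only [inv_pow, h.pp, div_pow, mul_pow]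
        generalize (l : F) ^ q = L at *
        generalize (b : F) ^ q = B at *
        field_simp
      · push_cast
        simp only [inv_pow, h.pp]
        generalize (l : F) ^ q = L at *
        field_simp
      · push_cast
        simp only [inv_pow, h.pp]
        generalize (l : F) ^ q = L at *
        field_simp

/-- The pair is that of the product of the right factor in P(a, b) and the left factor in P(0, c),
so closure under multiplication gives the condition. -/
theorem TraceCond.middle (h : QuadConj F q) {a : F} {b c d s : Fˣ}
    (H : TraceCond q a (b : F)) (hc : (c : F) ^ q = -c) (hs : (s : F) = b + c)
    (hd : d = s / (b * c)) : TraceCond q (-(a / b)) (d : F) := by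
  have hb : (b : F) ≠ 0 := b.ne_zero
  have hcne : (c : F) ≠ 0 := c.ne_zero
  have Hc : TraceCond q 0 (c : F) := by
    unfold TraceCond; rw [hc]; ring
  have := (H.right h).mul h (Hc.left h)
  convert this using 1
  · simp
  · rw [hd, zero_div, neg_zero, h.zero, mul_zero, sub_zero]
    push_cast
    rw [hs]
    field_simp
    ring

/-- Multiplying P(a, b) by P(0, c) leaves, between two copies of T, the product ν(-a/b, 1/b) ν(0,
1/c) = ν(-a/b, d), once a torus element is pushed through T. Applying P to this middle element
removes one T, and collecting the outer factors yields the relation for the product. -/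
theorem PRel.mul (h : QuadConj F q) (R : BorelRules q N D T) {a : F} {b c d s : Fˣ}
    (H : TraceCond q a (b : F)) (hc : (c : F) ^ q = -c) (hs : (s : F) = b + c)
    (hd : d = s / (b * c))
    (E₁ : PRel q N D T a b) (E₂ : PRel q N D T 0 c) (E₃ : PRel q N D T (-(a / b)) d) :
    PRel q N D T a s := by
  have hb : (b : F) ≠ 0 := b.ne_zero
  have hB : (b : F) ^ q ≠ 0 := pow_ne_zero q hb
  have hcne : (c : F) ≠ 0 := c.ne_zero
  have hsne : (s : F) ≠ 0 := s.ne_zero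
  have hS : (s : F) ^ q ≠ 0 := pow_ne_zero q hsne
  have hdF : (d : F) = s / (b * c) := by rw [hd]; push_cast; rfl
  have hdq : (d : F) ^ q = (s : F) ^ q / ((b : F) ^ q * -c) := by
    rw [hdF, div_pow, mul_pow, hc]
  have hsq : (s : F) ^ q = (b : F) ^ q - c := by rw [hs, h.add, hc]; ring
  have Hc : TraceCond q 0 (c : F) := by
    unfold TraceCond; rw [hc]; ring
  have Hd := H.middle h hc hs hd
  have g1 : N a (s : F) = N a b * N 0 c := by
    rw [R.mul _ _ _ _ H Hc, hs, h.zero, mul_zero, add_zero, sub_zero]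
  have g2 : N (-(a / b)) (b : F)⁻¹ * N 0 (c : F)⁻¹ = N (-(a / b)) d := by
    have := R.mul _ _ _ _ (H.right h) (Hc.left h)
    rw [zero_div, neg_zero] at this
    rw [this, hdF, h.zero, mul_zero, sub_zero, add_zero, hs]
    congr 1
    field_simp
    ring
  have Hcr : TraceCond q 0 (c : F)⁻¹ := by simpa using Hc.right h
  unfold PRel at E₁ E₂ E₃ ⊢
  rw [zero_div, neg_zero, zero_div, neg_zero] at E₂
  have e1 := R.N_mul_D (Hd.right h) c
  have e2 := R.conj _ _ (b ^ q) (Hd.left h)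
  have e3 := R.mul _ _ _ _ (H.left h) ((Hd.left h).conj h (b ^ q))
  have e4 := R.mul _ _ _ _ ((Hd.right h).conj h c) Hcr
  have e5 : D (b ^ q)⁻¹ * D (d ^ q)⁻¹ * D (c ^ q)⁻¹ = D (s ^ q)⁻¹ := by
    rw [← map_mul, ← map_mul, hd]
    congr 1
    rw [← mul_inv, ← mul_inv, ← mul_pow, ← mul_pow, mul_right_comm, mul_div_cancel]
  calc T * N a s * T = (T * N a b * T) * (T * N 0 c * T) := by
        rw [g1]
        simp only [mul_assoc]
        rw [← mul_assoc T T, R.TT, one_mul]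
    _ = N (-(a / (b : F) ^ q)) (b : F)⁻¹ * D (b ^ q)⁻¹ * T *
          (N (-(a / b)) (b : F)⁻¹ * N 0 (c : F)⁻¹) * (D (c ^ q)⁻¹ * T) * N 0 (c : F)⁻¹ := by
        rw [E₁, E₂]
        simp only [mul_assoc]
    _ = N (-(a / (b : F) ^ q)) (b : F)⁻¹ * D (b ^ q)⁻¹ * (T * N (-(a / b)) d * T) * D c *
          N 0 (c : F)⁻¹ := by
        rw [g2, ← R.T_mul_D]
        simp only [mul_assoc]
    _ = N (-(a / (b : F) ^ q)) (b : F)⁻¹ *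
          ((D (b ^ q))⁻¹ * N (-(-(a / b) / (d : F) ^ q)) (d : F)⁻¹ * D (b ^ q)) *
          (D (b ^ q)⁻¹ * D (d ^ q)⁻¹) * T * (N (-(-(a / b) / d)) (d : F)⁻¹ * D c) *
          N 0 (c : F)⁻¹ := by
        rw [E₃, map_inv D (b ^ q)]
        group
    _ = _ := by
        rw [e1, e2, ← mul_assoc, e3]
        calc _ = N (-(a / (b : F) ^ q) + -(-(a / b) / (d : F) ^ q) * ((b ^ q : Fˣ) : F) ^ q /
                  ((b ^ q : Fˣ) : F) ^ 2)
                ((b : F)⁻¹ + (d : F)⁻¹ / (((b ^ q : Fˣ) : F) * ((b ^ q : Fˣ) : F) ^ q) -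
                  -(a / (b : F) ^ q) * (-(-(a / b) / (d : F) ^ q) * ((b ^ q : Fˣ) : F) ^ q /
                  ((b ^ q : Fˣ) : F) ^ 2) ^ q) * (D (b ^ q)⁻¹ * D (d ^ q)⁻¹) * (T * D c) *
              (N (-(-(a / b) / d) * (c : F) ^ q / (c : F) ^ 2)
                ((d : F)⁻¹ / (c * (c : F) ^ q)) * N 0 (c : F)⁻¹) := by simp only [mul_assoc]
          _ = N (-(a / (s : F) ^ q)) (s : F)⁻¹ * (D (b ^ q)⁻¹ * D (d ^ q)⁻¹) * (T * D c) *
              N (-(a / s)) (s : F)⁻¹ := by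
            rw [e4]
            unfold TraceCond at H
            congr 3
            · congr 1
              · push_cast
                rw [h.pp, hdq]
                generalize (s : F) ^ q = S at *
                generalize (b : F) ^ q = B at *
                subst hsq
                field_simp
                ring
              · push_cast
                simp only [h.pp, h.neg, div_pow, mul_pow, pow_right_comm _ 2 q, hdF]
                generalize (s : F) ^ q = S at *
                generalize (b : F) ^ q = B at *
                generalize a ^ q = A at *
                field_simp
                rw [hs]
                linear_combination c * H
            · rw [hc, hdF]
              field_simp
              ring
            · rw [hc, hdF, h.zero, hs]
              rw [hs] at hsne
              field_simp
              ring
          _ = _ := by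
            rw [R.T_mul_D, ← e5]
            simp only [mul_assoc]

end Rules

/-! ### Powers, norms and the fixed field in the cyclic group F^×. -/

section Cyclic

variable {F : Type*} [Field F] {q : ℕ} {ω : Fˣ}

theorem orderOf_primitive (hF : Nat.card F = q ^ 2)
    (hω : ∀ x : Fˣ, x ∈ Subgroup.zpowers ω) : orderOf ω = q ^ 2 - 1 := by
  rw [orderOf_eq_card_of_forall_mem_zpowers hω, Nat.card_units, hF]

theorem zetaElt_ne_zero : zetaElt q ω ≠ 0 := neg_ne_zero.2 (pow_ne_zero _ ω.ne_zero)

theorem cube_eq_div (h : QuadConj F q) (y : Fˣ) : ∃ l : Fˣ, l ^ q / l ^ 2 = y ^ 3 := by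
  -- -(q + 2)(q - 2) = 4 - q², which is 3 modulo q² - 1.
  refine ⟨(y ^ (q + 2))⁻¹, ?_⟩
  rw [inv_pow, ← pow_mul, add_mul, pow_add, pow_mul, h.unit_pp, inv_pow, ← pow_mul, div_inv_eq_mul,
    add_mul, pow_add, mul_comm q 2, mul_inv]
  group

/-- The (q-2)-th powers form a subgroup containing all x^3 and x^(q-2); when 3 does not divide q -
2, these two generate x. -/
theorem eq_div_of_not_modEq (h : QuadConj F q) (h3 : ¬ q ≡ 2 [MOD 3]) (x : Fˣ) :
    ∃ l : Fˣ, l ^ q / l ^ 2 = x := by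
  let f : Fˣ →* Fˣ := powMonoidHom q / powMonoidHom 2
  have h1 : x ^ 3 ∈ f.range := cube_eq_div h x
  have h2 : x ^ q / x ^ 2 ∈ f.range := ⟨x, rfl⟩
  change x ∈ f.range
  have h4 : q = 3 * (q / 3) + q % 3 := (Nat.div_add_mod q 3).symm
  have h5 : q % 3 = 0 ∨ q % 3 = 1 := by
    unfold Nat.ModEq at h3
    omega
  have h6 := pow_mem h1 (q / 3)
  rw [h4, pow_add, pow_mul] at h2
  rcases h5 with h5 | h5 <;> rw [h5] at h2
  · have := mul_mem (mul_mem (inv_mem h6) h2) h1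
    convert this using 1
    rw [mul_div_assoc, inv_mul_cancel_left, div_eq_mul_inv]
    group
  · have := mul_mem (inv_mem h2) h6
    convert this using 1
    rw [mul_div_assoc, mul_inv, mul_right_comm, inv_mul_cancel, one_mul,
      div_eq_mul_inv]
    group

/-- The order of ω is (q + 1)(q - 1), so GF(q)^× consists of the powers of ω^(q+1). -/
theorem zpow_fixed_iff (hq : 2 < q) (hF : Nat.card F = q ^ 2)
    (hω : ∀ x : Fˣ, x ∈ Subgroup.zpowers ω) (n : ℤ) :
    (ω ^ n) ^ q = ω ^ n ↔ (q + 1 : ℤ) ∣ n := by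
  have ho : (orderOf ω : ℤ) = (q + 1) * (q - 1) := by
    have := Nat.one_le_pow 2 q (by omega)
    rw [orderOf_primitive hF hω]
    push_cast [this]
    ring
  have h1 : (ω ^ n) ^ q = ω ^ n ↔ ω ^ (n * (q - 1)) = 1 := by
    rw [mul_sub, zpow_sub, mul_one, zpow_mul, zpow_natCast, mul_inv_eq_one]
  rw [h1, ← orderOf_dvd_iff_zpow_eq_one, ho]
  exact mul_dvd_mul_iff_right (by omega)

theorem exists_mul_pow_eq (hq : 2 < q) (hF : Nat.card F = q ^ 2)
    (hω : ∀ x : Fˣ, x ∈ Subgroup.zpowers ω) {g : F} (hg : g ≠ 0) (hgq : g ^ q = g) :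
    ∃ l : Fˣ, (l : F) * (l : F) ^ q = g := by
  obtain ⟨n, hn⟩ := hω (Units.mk0 g hg)
  obtain ⟨j, rfl⟩ := (zpow_fixed_iff hq hF hω n).1 (by
    simp only at hn
    rw [hn]
    ext
    exact hgq)
  refine ⟨ω ^ j, ?_⟩
  have := congrArg Units.val hn
  simp only [Units.val_mk0] at this
  rw [← this, ← Units.val_pow_eq_pow_val, ← Units.val_mul, ← pow_succ', mul_comm, zpow_mul]
  norm_cast

variable [Finite F]

theorem two_eq_zero_of_even (hF : Nat.card F = q ^ 2) (he : Even q) : (2 : F) = 0 := by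
  obtain ⟨p, k, hp, hc, rfl⟩ := prime_pow_of_card hF
  have h2 : p = 2 := ((Nat.prime_dvd_prime_iff_eq Nat.prime_two hp).1
    (Nat.prime_two.dvd_of_dvd_pow he.two_dvd)).symm
  subst h2
  exact_mod_cast CharP.cast_eq_zero F 2

theorem two_ne_zero_of_odd (hq : 2 < q) (hF : Nat.card F = q ^ 2) (he : ¬ Even q) :
    (2 : F) ≠ 0 := by
  obtain ⟨p, k, hp, hc, rfl⟩ := prime_pow_of_card hF
  intro h
  have : p ∣ 2 := (CharP.cast_eq_zero_iff F p 2).1 (by exact_mod_cast h)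
  rw [Nat.prime_dvd_prime_iff_eq hp Nat.prime_two] at this
  subst this
  refine he ((Nat.even_pow).2 ⟨even_two, ?_⟩)
  rintro rfl
  omega

/-- The square of ζ is ω^(q(q+1)), which lies in GF(q), so ζ^q = ±ζ. The plus sign would make q + 1
divide (q² + q)/2, which forces q even; then the signs agree. -/
theorem zetaElt_pow (hq : 2 < q) (hF : Nat.card F = q ^ 2)
    (hω : ∀ x : Fˣ, x ∈ Subgroup.zpowers ω) : zetaElt q ω ^ q = -zetaElt q ω := by
  have h := quadConj_of_card hq hF
  have h2 : 2 * ((q ^ 2 + q) / 2) = (q + 1) * q := by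
    have : 2 ∣ q ^ 2 + q := by
      have := Nat.even_mul_succ_self q
      rw [sq]
      simpa [mul_add] using this.two_dvd
    rw [Nat.mul_div_cancel' this]
    ring
  unfold zetaElt
  rw [h.neg]
  generalize (q ^ 2 + q) / 2 = m at h2
  have h3 : ((ω : F) ^ m) ^ 2 = (((ω : F) ^ m) ^ q) ^ 2 := by
    have := (zpow_fixed_iff hq hF hω ((2 * m : ℕ) : ℤ)).2 ⟨q, by exact_mod_cast h2⟩
    rw [zpow_natCast] at this
    have := congrArg Units.val this
    push_cast at this
    rw [pow_right_comm _ q 2, ← pow_mul _ m 2, mul_comm m 2, this]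
  rcases sq_eq_sq_iff_eq_or_eq_neg.1 h3 with h4 | h4
  · have h5 : (q + 1 : ℤ) ∣ (m : ℕ) := (zpow_fixed_iff hq hF hω m).1
      (by rw [zpow_natCast]; exact Units.ext (by push_cast; exact h4.symm))
    obtain ⟨j, hj⟩ : (q + 1) ∣ m := by exact_mod_cast h5
    have h6 : 2 * j = q := by
      apply Nat.eq_of_mul_eq_mul_left (Nat.succ_pos q)
      rw [Nat.succ_eq_add_one, ← h2, hj]
      ring
    have h7 := two_eq_zero_of_even hF ⟨j, by omega⟩
    rw [← h4, neg_neg]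
    linear_combination (-(ω : F) ^ m) * h7
  · rw [neg_neg]
    exact h4.symm

end Cyclic

/-! ### From the relations of classes 0 and 1 to all P(u). -/

section Chain

variable {F : Type*} [Field F] {q : ℕ} {ω : Fˣ} {Γ : Type*} [Group Γ]
  {N : F → F → Γ} {D : Fˣ →* Γ} {T : Γ}

/-- Passing from a₀ to a = a₀ l^(q-2) divides the norm by N(l) = l^(q+1). As b is a GF(q)-multiple
of b₀ and tr b₀ ≠ 0, the trace condition forces b = b₀/N(l), so the two elements are conjugate under
Δ(l). -/
theorem PRel.conj_of_div (h : QuadConj F q) (R : BorelRules q N D T) {a₀ a : F} {b₀ b : Fˣ}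
    (H₀ : TraceCond q a₀ (b₀ : F)) (H : TraceCond q a (b : F)) (E : PRel q N D T a₀ b₀)
    (ha₀ : a₀ ≠ 0) {c : F} (hc : c ^ q = c) (hb : (b : F) = c * b₀) {l : Fˣ}
    (hl : (l : F) ^ q / (l : F) ^ 2 = a / a₀) : PRel q N D T a b := by
  have hl0 : (l : F) ≠ 0 := l.ne_zero
  have hL : (l : F) ^ q ≠ 0 := pow_ne_zero q hl0
  have hA : a₀ ^ q ≠ 0 := pow_ne_zero q ha₀
  have e1 : a = a₀ * (l : F) ^ q / (l : F) ^ 2 := by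
    rw [mul_div_assoc, hl]
    field_simp
  have e2 : (b : F) = b₀ / (l * (l : F) ^ q) := by
    unfold TraceCond at H₀ H
    have h1 := congrArg (· ^ q) e1
    simp only [div_pow, mul_pow, h.pp, pow_right_comm _ 2 q] at h1
    rw [hb, mul_pow, hc, h1] at H
    rw [e1] at H
    have h2 : c * (l * (l : F) ^ q) = 1 := by
      generalize (l : F) ^ q = L at *
      apply mul_right_cancel₀ (mul_ne_zero ha₀ hA)
      field_simp at H
      linear_combination (c * l * L) * H₀ - H
    rw [hb, eq_div_iff (mul_ne_zero hl0 hL), mul_right_comm, h2, one_mul]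
  have e3 : b = b₀ / (l * l ^ q) := Units.ext (by push_cast; exact e2)
  rw [e1, e3]
  exact E.conj h R H₀ l

/-- Two nonzero elements of trace 0 differ by a factor in GF(q)^×, and every such factor is a norm.
-/
theorem PRel.central (h : QuadConj F q) (hF : Nat.card F = q ^ 2)
    (hω : ∀ x : Fˣ, x ∈ Subgroup.zpowers ω) (R : BorelRules q N D T) {c₀ c : Fˣ}
    (hc₀ : (c₀ : F) ^ q = -c₀) (hc : (c : F) ^ q = -c) (E : PRel q N D T 0 c₀) :
    PRel q N D T 0 c := by
  obtain ⟨l, hl⟩ := exists_mul_pow_eq h.two_lt hF hω (g := c₀ / c)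
    (div_ne_zero c₀.ne_zero c.ne_zero) (by rw [div_pow, hc, hc₀, neg_div_neg_eq])
  have e : c = c₀ / (l * l ^ q) := by
    ext
    push_cast
    rw [hl, div_div_cancel₀ c₀.ne_zero]
  have := E.conj h R (by unfold TraceCond; rw [hc₀]; ring) l
  rwa [zero_mul, zero_div, ← e] at this

variable [Finite F]

/-- Write b = b₁ + g with b₁ in class 1 and tr g = 0; composing drops the class of the remaining
relation by one. -/
theorem pRel_class (h : QuadConj F q) (hF : Nat.card F = q ^ 2)
    (hω : ∀ x : Fˣ, x ∈ Subgroup.zpowers ω) (R : BorelRules q N D T)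
    (E₀ : ∀ c : Fˣ, (c : F) ^ q = -c → PRel q N D T 0 c)
    (E₁ : ∀ (a : F) (b : Fˣ) (c : F), TraceCond q a (b : F) → c ^ q = c →
      (b : F) = c * (ω * zetaElt q ω) → PRel q N D T a b)
    {k : ℕ} (hk : 1 ≤ k) : k ≤ q → ∀ (a : F) (b : Fˣ) (c : F), TraceCond q a (b : F) →
      c ^ q = c → (b : F) = c * (ω ^ k * zetaElt q ω) → PRel q N D T a b := by
  have hw : (ω : F) ≠ 0 := ω.ne_zero
  have hζ := zetaElt_ne_zero (q := q) (ω := ω)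
  have hζq := zetaElt_pow h.two_lt hF hω
  have nf : ∀ k : ℕ, 1 ≤ k → k ≤ q → ((ω : F) ^ k) ^ q ≠ (ω : F) ^ k := by
    intro k h1 h2 h3
    have := (zpow_fixed_iff h.two_lt hF hω k).1
      (by rw [zpow_natCast]; exact Units.ext (by push_cast; exact h3))
    have := Nat.le_of_dvd h1 (by exact_mod_cast this)
    omega
  induction k, hk using Nat.le_induction with
  | base => intro _ a b c; simpa using E₁ a b c
  | succ k hk ih =>
    intro hkq a b c H hc hb
    have hb0 : (b : F) ≠ 0 := b.ne_zero
    have hc0 : c ≠ 0 := by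
      rintro rfl
      simp at hb
    have h1 : (ω : F) - (ω : F) ^ q ≠ 0 := by
      have := nf 1 le_rfl (by omega)
      rw [pow_one] at this
      exact sub_ne_zero.2 this.symm
    have hk1 : (ω : F) ^ (k + 1) - ((ω : F) ^ (k + 1)) ^ q ≠ 0 :=
      sub_ne_zero.2 (nf (k + 1) (by omega) hkq).symm
    -- Since tr(c ω^j ζ) = cζ(ω^j - ω^(jq)) for c in GF(q), this coefficient makes c₁ωζ have the
    -- same trace as b.
    set c₁ : F := c * ((ω : F) ^ (k + 1) - ((ω : F) ^ (k + 1)) ^ q) / (ω - (ω : F) ^ q) with hc₁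
    have hc₁q : c₁ ^ q = c₁ := by
      rw [hc₁, div_pow, mul_pow, hc, h.sub, h.sub, h.pp, h.pp, ← neg_sub, mul_neg,
        ← neg_sub (ω : F), neg_div_neg_eq]
    have hc₁0 : c₁ ≠ 0 := div_ne_zero (mul_ne_zero hc0 hk1) h1
    have hb₁0 : c₁ * (ω * zetaElt q ω) ≠ 0 := mul_ne_zero hc₁0 (mul_ne_zero hw hζ)
    obtain ⟨b₁, hb₁v⟩ : ∃ b₁ : Fˣ, (b₁ : F) = c₁ * (ω * zetaElt q ω) := ⟨Units.mk0 _ hb₁0, rfl⟩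
    have htr : (b₁ : F) + (b₁ : F) ^ q = b + (b : F) ^ q := by
      rw [hb₁v, hb]
      simp only [mul_pow _ _ q, hζq, hc, hc₁q]
      have : c₁ * (ω - (ω : F) ^ q) = c * ((ω : F) ^ (k + 1) - ((ω : F) ^ (k + 1)) ^ q) := by
        rw [hc₁]
        field_simp
      linear_combination zetaElt q ω * this
    -- Equality would put ω^k in GF(q), impossible for 1 ≤ k ≤ q.
    have hγ0 : (b : F) - b₁ ≠ 0 := by
      intro h0
      rw [hb, hb₁v] at h0
      apply nf k hk (by omega)
      have : (ω : F) ^ k = c₁ / c := by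
        rw [eq_div_iff hc0]
        apply mul_right_cancel₀ (mul_ne_zero hw hζ)
        linear_combination h0
      rw [this, div_pow, hc, hc₁q]
    have H₁ : TraceCond q a (b₁ : F) := htr.trans H
    obtain ⟨g, hg⟩ : ∃ g : Fˣ, (g : F) = b - b₁ := ⟨Units.mk0 _ hγ0, rfl⟩
    have hγ : (g : F) ^ q = -g := by
      rw [hg, h.sub]
      linear_combination -htr
    have hs : (b : F) = b₁ + g := by rw [hg]; ring
    refine PRel.mul h R H₁ hγ hs rfl (E₁ a b₁ c₁ H₁ hc₁q hb₁v) (E₀ _ hγ) ?_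
    -- b/(b₁g) = (c/(c₁gζ)) ω^k ζ, and gζ is fixed by x ↦ x^q because both factors change sign.
    refine ih (by omega) _ _ (c / (c₁ * (g * zetaElt q ω))) (H₁.middle h hγ hs rfl) ?_ ?_
    · rw [div_pow, mul_pow, mul_pow, hc, hc₁q, hγ, hζq, neg_mul_neg]
    · push_cast
      rw [hb₁v, hb]
      have hg0 := g.ne_zero
      field_simp
      ring

theorem pRel_all (h : QuadConj F q) (hF : Nat.card F = q ^ 2)
    (hω : ∀ x : Fˣ, x ∈ Subgroup.zpowers ω) (R : BorelRules q N D T)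
    (E₀ : ∀ c : Fˣ, (c : F) ^ q = -c → PRel q N D T 0 c)
    (E₁ : ∀ (a : F) (b : Fˣ) (c : F), TraceCond q a (b : F) → c ^ q = c →
      (b : F) = c * (ω * zetaElt q ω) → PRel q N D T a b)
    {a : F} {b : Fˣ} (H : TraceCond q a (b : F)) : PRel q N D T a b := by
  have hζ := zetaElt_ne_zero (q := q) (ω := ω)
  have hζq := zetaElt_pow h.two_lt hF hω
  by_cases hb : (b : F) ^ q = -b
  · have ha : a = 0 := by
      unfold TraceCond at H
      rw [hb, add_neg_cancel, eq_comm, neg_eq_zero, mul_eq_zero] at H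
      exact H.elim id eq_zero_of_pow_eq_zero
    rw [ha]
    exact E₀ b hb
  · obtain ⟨n, hn⟩ := hω (b / Units.mk0 _ hζ)
    simp only at hn
    have hn' : (b : F) = ((ω ^ n : Fˣ) : F) * zetaElt q ω := by
      rw [hn]
      push_cast
      rw [Units.val_mk0]
      field_simp
    have hq0 : (0 : ℤ) < q + 1 := by omega
    -- The class of b is n mod q + 1; residue 0 would give b trace zero.
    obtain ⟨k, hk⟩ := Int.eq_ofNat_of_zero_le (Int.emod_nonneg n hq0.ne')
    have hk2 := Int.emod_lt_of_pos n hq0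
    have hd : n = (q + 1) * (n / (q + 1)) + k := by
      rw [← hk]
      exact (Int.mul_ediv_add_emod n (q + 1)).symm
    have hk1 : 1 ≤ k := by
      by_contra h0
      have hk0 : k = 0 := by omega
      apply hb
      have := (zpow_fixed_iff h.two_lt hF hω n).2 ⟨_, by rw [hk0] at hd; simpa using hd⟩
      have := congrArg Units.val this
      push_cast at this
      rw [hn', mul_pow, hζq, Units.val_zpow_eq_zpow_val, this]
      ring
    refine pRel_class h hF hω R E₀ E₁ hk1 (by omega) a b
      ((ω ^ (((q : ℤ) + 1) * (n / (q + 1))) : Fˣ) : F) H ?_ ?_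
    · have := (zpow_fixed_iff h.two_lt hF hω ((q + 1) * (n / (q + 1)))).2 ⟨_, rfl⟩
      exact_mod_cast congrArg Units.val this
    · rw [hn', ← mul_assoc]
      congr 1
      conv_lhs => rw [hd, zpow_add]
      push_cast
      simp

end Chain

/-! ### The Borel subgroup, and generation of SU(3, q) by it and t. -/

section Borel

variable {F : Type*} [Field F] {q : ℕ} {ω : Fˣ}

/-- The upper triangular matrices in `SL(3, F)`. -/
def upperSL (F : Type*) [Field F] : Subgroup (SL3 F) where
  carrier := {A | A.1 1 0 = 0 ∧ A.1 2 0 = 0 ∧ A.1 2 1 = 0}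
  one_mem' := by simp
  mul_mem' := by
    rintro A B ⟨a1, a2, a3⟩ ⟨b1, b2, b3⟩
    simp [Matrix.mul_apply, Fin.sum_univ_three, a1, a2, a3, b1, b2, b3]
  inv_mem' := by
    rintro A ⟨a1, a2, a3⟩
    simp [Matrix.SpecialLinearGroup.coe_inv, Matrix.adjugate_fin_three, a1, a2, a3]

theorem hermForm_row {A : SL3 F} (hA : A ∈ SU3 F q) (i j : Fin 3) :
    hermForm q (A.1 i) (A.1 j) = hermForm q (Pi.single i 1) (Pi.single j (1 : F)) := by
  have := hA (Pi.single i 1) (Pi.single j 1)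
  rwa [Matrix.single_one_vecMul, Matrix.single_one_vecMul] at this

theorem exists_eq_nuMat_mul_deltaHom (h : QuadConj F q) {A : SL3 F} (hA : A ∈ SU3 F q)
    (hu : A ∈ upperSL F) :
    ∃ (a b : F) (l : Fˣ), TraceCond q a b ∧ A = nuMat q a b * deltaHom F q l := by
  obtain ⟨h1, h2, h3⟩ := hu
  have e02 := hermForm_row hA 0 2
  have e01 := hermForm_row hA 0 1
  have e00 := hermForm_row hA 0 0
  have hd := A.2
  simp [hermForm, h.zero, h1, h2, h3] at e02 e01 e00
  rw [Matrix.det_fin_three] at hd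
  simp [h1, h2, h3] at hd
  have h0 : A.1 0 0 ≠ 0 := left_ne_zero_of_mul_eq_one e02
  have e22 : A.1 2 2 = (A.1 0 0 ^ q)⁻¹ := by
    rw [← inv_pow, ← eq_inv_of_mul_eq_one_right e02, h.pp]
  have hL : A.1 0 0 ^ q ≠ 0 := pow_ne_zero q h0
  have e11 : A.1 1 1 = A.1 0 0 ^ q / A.1 0 0 := by
    rw [e22] at hd
    field_simp at hd ⊢
    linear_combination hd
  have e12 : A.1 1 2 = -(A.1 0 1 ^ q / A.1 0 0) := by
    have := congrArg (· ^ q) (eq_neg_of_add_eq_zero_left e01)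
    simp only [mul_pow, h.neg, h.pp, e11, div_pow] at this
    field_simp at this ⊢
    linear_combination this
  refine ⟨A.1 0 1 * A.1 0 0 / A.1 0 0 ^ q, A.1 0 2 * A.1 0 0 ^ q, Units.mk0 _ h0, ?_, ?_⟩
  · unfold TraceCond
    simp only [mul_pow, div_pow, h.pp]
    field_simp
    linear_combination e00
  · apply Subtype.ext
    rw [Matrix.SpecialLinearGroup.coe_mul, deltaHom_val]
    ext i j
    fin_cases i <;> fin_cases j <;>
      simp [nuMat, Matrix.mul_apply, Fin.sum_univ_three, h1, h2, h3, e22, e11, e12, h.pp, mul_pow,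
        div_pow] <;> field_simp

theorem nuMat_mem_upperSL (a b : F) : nuMat q a b ∈ upperSL F := by
  refine ⟨?_, ?_, ?_⟩ <;> simp [nuMat]

theorem deltaHom_mem_upperSL (l : Fˣ) : deltaHom F q l ∈ upperSL F := by
  refine ⟨?_, ?_, ?_⟩ <;> simp [deltaHom_val]

/-- If l^q = l², then l = l^(q²) = l⁴, so the kernel consists of cube roots of unity. -/
theorem card_range_div (h : QuadConj F q) [Finite F] (hF : Nat.card F = q ^ 2) :
    q ^ 2 - 1 ≤ 3 * Nat.card (powMonoidHom q / powMonoidHom 2 : Fˣ →* Fˣ).range := by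
  set f : Fˣ →* Fˣ := powMonoidHom q / powMonoidHom 2
  have h1 : f.ker ≤ rootsOfUnity 3 F := by
    intro l hl
    have h2 : l ^ q = l ^ 2 := div_eq_one.1 (hl : l ^ q / l ^ 2 = 1)
    have h3 := h.unit_pp l
    rw [h2, ← pow_mul, mul_comm, pow_mul, h2, ← pow_mul] at h3
    rw [mem_rootsOfUnity]
    exact mul_right_cancel (b := l) (by rw [← pow_succ, one_mul, h3])
  have h2 : Nat.card f.ker ≤ 3 :=
    (Subgroup.card_le_of_le h1).trans (card_rootsOfUnity F 3)
  have h3 : Nat.card f.ker * Nat.card f.range = q ^ 2 - 1 := by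
    rw [← Subgroup.index_ker, Subgroup.card_mul_index, Nat.card_units, hF]
  rw [← h3]
  exact Nat.mul_le_mul_right _ h2

/-- The image is closed under multiplication, so its additive span is a subring, hence a subfield of
the finite field F. A proper subfield has at most q elements, too few to contain at least (q² - 1)/3
units when q > 2. -/
theorem closure_range_div (h : QuadConj F q) [Finite F] (hF : Nat.card F = q ^ 2) :
    AddSubgroup.closure (Set.range fun l : Fˣ => (l : F) ^ q / (l : F) ^ 2) = ⊤ := by
  set f : Fˣ →* Fˣ := powMonoidHom q / powMonoidHom 2 with hf
  set M : Submonoid F := MonoidHom.mrange ((Units.coeHom F).comp f) with hM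
  have hfv : ∀ l : Fˣ, ((Units.coeHom F).comp f) l = (l : F) ^ q / (l : F) ^ 2 := fun l => by
    simp [hf]
  have hMr : (M : Set F) = Set.range fun l : Fˣ => (l : F) ^ q / (l : F) ^ 2 := by
    rw [hM, MonoidHom.coe_mrange]
    exact congrArg Set.range (funext hfv)
  set K : Subring F := Subring.closure (M : Set F) with hK
  suffices H : K = ⊤ by
    rw [eq_top_iff]
    intro x _
    have hx : x ∈ K := H ▸ Subring.mem_top x
    rwa [hK, Subring.mem_closure_iff, Submonoid.closure_eq, hMr] at hx
  by_contra hne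
  obtain ⟨x, hx⟩ : ∃ x, x ∉ K := by
    by_contra! hall
    exact hne (eq_top_iff.2 fun x _ => hall x)
  have hinv : ∀ y ∈ K, y⁻¹ ∈ K := by
    intro y hy
    rcases eq_or_ne y 0 with rfl | hy0
    · simp
    · have := Fintype.ofFinite F
      have h1 := FiniteField.pow_card_sub_one_eq_one y hy0
      rw [← Nat.card_eq_fintype_card, hF] at h1
      have h2 : y ^ (q ^ 2 - 2) = y⁻¹ := by
        have := h.two_lt
        have : q ^ 2 - 1 = q ^ 2 - 2 + 1 := by
          have : 2 ≤ q ^ 2 := by nlinarith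
          omega
        rw [this, pow_succ] at h1
        exact eq_inv_of_mul_eq_one_left h1
      exact h2 ▸ pow_mem hy _
  -- For x outside the subfield K, the elements 1 and x are independent over K, so |K|² ≤ |F|.
  have hinj : Function.Injective fun p : K × K => (p.1 : F) + x * p.2 := by
    rintro ⟨a, b⟩ ⟨c, d⟩ e
    simp only at e
    by_cases hbd : b = d
    · subst hbd
      simpa using e
    · exfalso
      apply hx
      have hbd' : (b : F) - d ≠ 0 := sub_ne_zero.2 fun h' => hbd (Subtype.ext h')
      have : x = (c - a) * ((b : F) - d)⁻¹ := by
        field_simp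
        linear_combination e
      rw [this]
      exact K.mul_mem (K.sub_mem c.2 a.2) (hinv _ (K.sub_mem b.2 d.2))
  have h1 : Nat.card K * Nat.card K ≤ q ^ 2 := by
    rw [← hF, ← Nat.card_prod]
    exact Nat.card_le_card_of_injective _ hinj
  have h2 : Nat.card f.range + 1 ≤ Nat.card K := by
    rw [← Finite.card_option]
    refine Nat.card_le_card_of_injective
      (fun o : Option f.range => o.elim (0 : K) fun y => ⟨((y : Fˣ) : F), ?_⟩) ?_
    · obtain ⟨l, hl⟩ := y.2
      exact Subring.subset_closure ⟨l, by simp [← hl]⟩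
    · rintro (_ | y) (_ | z) hyz
      · rfl
      · exact absurd (congrArg Subtype.val hyz).symm (z : Fˣ).ne_zero
      · exact absurd (congrArg Subtype.val hyz) (y : Fˣ).ne_zero
      · exact congrArg some (Subtype.ext (Units.ext (congrArg Subtype.val hyz)))
  have h3 := card_range_div h hF
  have h4 := h.two_lt
  have h5 : Nat.card K ≤ q := by nlinarith
  -- This reads (q - 1)(q - 2) ≤ 0, contradicting q > 2.
  have h6 : q ^ 2 ≤ 3 * (q - 1) + 1 := by
    change q ^ 2 - 1 ≤ 3 * Nat.card f.range at h3
    omega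
  obtain ⟨k, rfl⟩ := Nat.exists_eq_add_of_lt h4
  have : 2 + k + 1 - 1 = k + 2 := by omega
  rw [this] at h6
  nlinarith

theorem deltaHom_mem_borelH (hω : ∀ x : Fˣ, x ∈ Subgroup.zpowers ω) (l : Fˣ) :
    deltaHom F q l ∈ borelH q ω := by
  obtain ⟨n, rfl⟩ := hω l
  simp only [map_zpow]
  have h : deltaHom F q ω ∈ borelH q ω := Subgroup.subset_closure (Or.inr (Or.inr rfl))
  exact zpow_mem h n

variable [Finite F]

theorem tauGen_eq (hq : 2 < q) (hF : Nat.card F = q ^ 2)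
    (hω : ∀ x : Fˣ, x ∈ Subgroup.zpowers ω) :
    ∃ c : Fˣ, (c : F) ^ q = -c ∧ tauGen q ω = nuMat q 0 (c : F) := by
  unfold tauGen
  split_ifs with he
  · refine ⟨1, ?_, by simp⟩
    have := two_eq_zero_of_even hF he
    simp only [Units.val_one, one_pow]
    linear_combination this
  · exact ⟨Units.mk0 _ zetaElt_ne_zero, zetaElt_pow hq hF hω, rfl⟩

theorem xiElt_trace (hq : 2 < q) (hF : Nat.card F = q ^ 2)
    (hω : ∀ x : Fˣ, x ∈ Subgroup.zpowers ω) : TraceCond q (1 : F) (xiElt q ω) := by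
  have h := quadConj_of_card hq hF
  have hw : (ω : F) ≠ 0 := ω.ne_zero
  unfold TraceCond xiElt
  split_ifs with he
  · have h2 := two_eq_zero_of_even hF he
    have hL : (ω : F) ^ q ≠ 0 := pow_ne_zero q hw
    have e : (ω : F) ^ (q - 1) = (ω : F) ^ q / ω := 
      eq_div_of_mul_eq hw (pow_sub_one_mul (by omega) _)
    have hne : (ω : F) + (ω : F) ^ q ≠ 0 := by
      intro h0
      have h1 : ω ^ q = ω := Units.ext (by push_cast; linear_combination h0 - (ω : F) * h2)
      have h3 := (zpow_fixed_iff hq hF hω 1).1 (by simpa using h1)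
      have := Int.le_of_dvd one_pos h3
      omega
    rw [e, div_pow, h.add, div_pow, h.pp, one_pow]
    generalize (ω : F) ^ q = L at *
    have hne' : L + ω ≠ 0 := by rwa [add_comm]
    field_simp
    linear_combination (L + ω) ^ 2 * h2
  · have h2 := two_ne_zero_of_odd hq hF he
    have h2q : (2 : F) ^ q = 2 := by
      rw [← one_add_one_eq_two, h.add, one_pow]
    rw [div_pow, h.neg, one_pow, h2q]
    field_simp
    norm_num

/-- Conjugates of τ fill the group of all ν(0, c) with c of trace 0. Conjugates of ν have first
parameters that span F additively, so every a occurs with some b', and ν(a, b), ν(a, b') differ by a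
central factor. -/
theorem nuMat_mem_borelH (hq : 2 < q) (hF : Nat.card F = q ^ 2)
    (hω : ∀ x : Fˣ, x ∈ Subgroup.zpowers ω) {a b : F} (H : TraceCond q a b) :
    nuMat q a b ∈ borelH q ω := by
  have h := quadConj_of_card hq hF
  have hconj : ∀ (a b : F) (l : Fˣ), nuMat q a b ∈ borelH q ω →
      nuMat q (a * (l : F) ^ q / (l : F) ^ 2) (b / (l * (l : F) ^ q)) ∈ borelH q ω := by
    intro a b l hab
    rw [← nuMat_conj h]
    have := deltaHom_mem_borelH (q := q) hω l
    exact mul_mem (mul_mem (inv_mem this) hab) this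
  have hZ : ∀ c : F, c ^ q = -c → nuMat q 0 c ∈ borelH q ω := by
    intro c hc
    rcases eq_or_ne c 0 with rfl | hc0
    · rw [nuMat_zero h]
      exact one_mem _
    obtain ⟨θ, hθ, hτ⟩ := tauGen_eq hq hF hω
    obtain ⟨l, hl⟩ := exists_mul_pow_eq hq hF hω (g := θ / c)
      (div_ne_zero θ.ne_zero hc0) (by rw [div_pow, hc, hθ, neg_div_neg_eq])
    have := hconj 0 θ l (hτ ▸ Subgroup.subset_closure (by simp))
    rwa [zero_mul, zero_div, hl, div_div_cancel₀ θ.ne_zero] at this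
  have hA : ∀ a : F, ∃ b, TraceCond q a b ∧ nuMat q a b ∈ borelH q ω := by
    intro a
    have ha : a ∈ AddSubgroup.closure (Set.range fun l : Fˣ => (l : F) ^ q / (l : F) ^ 2) := by
      rw [closure_range_div h hF]
      trivial
    induction ha using AddSubgroup.closure_induction with
    | mem x hx =>
      obtain ⟨l, rfl⟩ := hx
      have h1 := xiElt_trace hq hF hω
      have := hconj 1 _ l (Subgroup.subset_closure (by simp [nuGen]) :
        nuMat q 1 (xiElt q ω) ∈ borelH q ω)
      have h2 := h1.conj h l
      rw [one_mul] at this h2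
      exact ⟨_, h2, this⟩
    | zero => exact ⟨0, by unfold TraceCond; simp [h.zero], hZ 0 (by simp [h.zero])⟩
    | add x y _ _ hx hy =>
      obtain ⟨b, hb, hb'⟩ := hx
      obtain ⟨c, hc, hc'⟩ := hy
      exact ⟨_, hb.mul h hc, nuMat_mul h x b y c ▸ mul_mem hb' hc'⟩
    | neg x _ hx =>
      obtain ⟨b, hb, hb'⟩ := hx
      refine ⟨b ^ q, ?_, ?_⟩
      · unfold TraceCond at *
        rw [h.pp, h.neg]
        linear_combination hb
      · have : nuMat q (-x) (b ^ q) = (nuMat q x b)⁻¹ := by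
          refine eq_inv_of_mul_eq_one_right ?_
          rw [nuMat_mul h, h.neg, add_neg_cancel, ← nuMat_zero h]
          congr 1
          unfold TraceCond at hb
          linear_combination hb
        exact this ▸ inv_mem hb'
  obtain ⟨b', hb', hm⟩ := hA a
  have e : nuMat q a b = nuMat q a b' * nuMat q 0 (b - b') := by
    rw [nuMat_mul h, h.zero]
    congr 1 <;> ring
  rw [e]
  refine mul_mem hm (hZ _ ?_)
  unfold TraceCond at H hb'
  rw [h.sub]
  linear_combination H - hb'

theorem mem_borelH_iff (hq : 2 < q) (hF : Nat.card F = q ^ 2)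
    (hω : ∀ x : Fˣ, x ∈ Subgroup.zpowers ω) (A : SL3 F) :
    A ∈ borelH q ω ↔ A ∈ SU3 F q ∧ A ∈ upperSL F := by
  have h := quadConj_of_card hq hF
  constructor
  · intro hA
    have : borelH q ω ≤ SU3 F q ⊓ upperSL F := by
      refine (Subgroup.closure_le _).2 ?_
      rintro B (rfl | rfl | rfl)
      · exact ⟨nuMat_mem_SU3 h (xiElt_trace hq hF hω), nuMat_mem_upperSL _ _⟩
      · obtain ⟨c, hc, e⟩ := tauGen_eq hq hF hω
        rw [e]
        exact ⟨nuMat_mem_SU3 h (by rw [hc]; ring), nuMat_mem_upperSL _ _⟩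
      · exact ⟨deltaHom_mem_SU3 h ω, deltaHom_mem_upperSL ω⟩
    exact this hA
  · rintro ⟨h1, h2⟩
    obtain ⟨a, b, l, H, rfl⟩ := exists_eq_nuMat_mul_deltaHom h h1 h2
    exact mul_mem (nuMat_mem_borelH hq hF hω H) (deltaHom_mem_borelH hω l)

/-- The last row is isotropic. If its first entry is 0, isotropy and orthogonality to the middle row
make the matrix upper triangular; otherwise multiplication by a suitable ν(a, b)t reduces to that
case. -/
theorem closure_su3Gens (hq : 2 < q) (hF : Nat.card F = q ^ 2)
    (hω : ∀ x : Fˣ, x ∈ Subgroup.zpowers ω) {A : SL3 F} (hA : A ∈ SU3 F q) {K : Subgroup (SL3 F)}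
    (hK : borelH q ω ≤ K) (hT : tMat F ∈ K) : A ∈ K := by
  have h := quadConj_of_card hq hF
  have key : ∀ B ∈ SU3 F q, B.1 2 0 = 0 → B ∈ K := by
    intro B hB h20
    have e22 := hermForm_row hB 2 2
    simp [hermForm, h.zero, h20] at e22
    have h21 : B.1 2 1 = 0 := e22.elim id fun h' => h'.1
    have e21 := hermForm_row hB 2 1
    simp [hermForm, h.zero, h20, h21] at e21
    have h22 : B.1 2 2 ≠ 0 := by
      intro h22
      have hd := B.2
      rw [Matrix.det_fin_three] at hd
      simp [h20, h21, h22] at hd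
    have h10 : B.1 1 0 = 0 := by
      rcases e21 with e | e
      · exact absurd e h22
      · exact e.1
    exact hK ((mem_borelH_iff hq hF hω B).2 ⟨hB, h10, h20, h21⟩)
  by_cases h20 : A.1 2 0 = 0
  · exact key A hA h20
  · have e22 := hermForm_row hA 2 2
    simp [hermForm, h.zero] at e22
    set x := A.1 2 0
    set y := A.1 2 1
    set z := A.1 2 2
    have hX : x ^ q ≠ 0 := pow_ne_zero q h20
    -- These parameters make ν(a, b) send the row (x, y, z) to (x, 0, 0), which t then sends to (0,
    -- 0, x).
    have H : TraceCond q (-(y / x)) (-(y / x * (y ^ q / x ^ q)) - z / x) := by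
      unfold TraceCond
      simp only [h.sub, h.neg, mul_pow, div_pow, h.pp]
      field_simp
      linear_combination -e22
    have hν := nuMat_mem_SU3 h H
    have hB := key _ (mul_mem (mul_mem hA hν) (tMat_mem_SU3 h)) (by
      have hx : A.1 2 0 = x := rfl
      have hy : A.1 2 1 = y := rfl
      have hz : A.1 2 2 = z := rfl
      rw [Matrix.SpecialLinearGroup.coe_mul, Matrix.SpecialLinearGroup.coe_mul]
      simp [Matrix.mul_apply, Fin.sum_univ_three, hx, hy, hz, nuMat, tMat, h.neg, div_pow]
      field_simp
      ring)
    rw [mul_assoc] at hB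
    exact (mul_mem_cancel_right (mul_mem (hK (nuMat_mem_borelH hq hF hω H)) hT)).1 hB

end Borel

/-! ### The Bruhat decomposition in a group that receives H. -/

section Amalgam

variable {F : Type*} [Field F] {q : ℕ} {ω : Fˣ} {Γ : Type*} [Group Γ]

open Classical in
/-- The image of `ν(a, b)` under a homomorphism defined on the Borel subgroup. -/
noncomputable def mapNu (ι : borelH q ω →* Γ) (a b : F) : Γ :=
  if hm : nuMat q a b ∈ borelH q ω then ι ⟨_, hm⟩ else 1

/-- The image of `Δ(l)` under a homomorphism defined on the Borel subgroup. -/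
def mapDelta (hω : ∀ x : Fˣ, x ∈ Subgroup.zpowers ω) (ι : borelH q ω →* Γ) : Fˣ →* Γ :=
  ι.comp ((deltaHom F q).codRestrict (borelH q ω) (deltaHom_mem_borelH hω))

theorem mapNu_eq (ι : borelH q ω →* Γ) {a b : F} {x : borelH q ω}
    (hx : (x : SL3 F) = nuMat q a b) : mapNu ι a b = ι x := by
  have hm : nuMat q a b ∈ borelH q ω := hx ▸ x.2
  rw [mapNu, dif_pos hm]
  exact congrArg ι (Subtype.ext hx.symm)

theorem mapDelta_eq (hω : ∀ x : Fˣ, x ∈ Subgroup.zpowers ω) (ι : borelH q ω →* Γ) {l : Fˣ}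
    {x : borelH q ω} (hx : (x : SL3 F) = deltaHom F q l) : mapDelta hω ι l = ι x :=
  congrArg ι (Subtype.ext hx.symm)

theorem traceCond_of_mem_SU3 (h : QuadConj F q) {a b : F} (hm : nuMat q a b ∈ SU3 F q) :
    TraceCond q a b := by
  have e := hermForm_row hm 0 0
  simp [hermForm, nuMat, h.zero] at e
  unfold TraceCond
  linear_combination e

variable [Finite F]

/-- The rules for unipotents assume `TraceCond`, which puts ν(a, b) in H, so the default value of
`mapNu` does not enter them. The torus is cyclic, so the action of T on it need only be known at ω.
-/
theorem borelRules_map (hq : 2 < q) (hF : Nat.card F = q ^ 2)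
    (hω : ∀ x : Fˣ, x ∈ Subgroup.zpowers ω) (ι : borelH q ω →* Γ) {T : Γ} (hT : T * T = 1)
    (hTD : T * mapDelta hω ι ω * T = mapDelta hω ι (ω ^ q)⁻¹) :
    BorelRules q (mapNu ι) (mapDelta hω ι) T := by
  have h := quadConj_of_card hq hF
  have hTi : T⁻¹ = T := inv_eq_of_mul_eq_one_right hT
  refine ⟨fun a b c d H H' => ?_, fun a b l H => ?_, hT, fun l => ?_⟩
  · rw [mapNu_eq ι (x := ⟨_, nuMat_mem_borelH hq hF hω H⟩) rfl,
      mapNu_eq ι (x := ⟨_, nuMat_mem_borelH hq hF hω H'⟩) rfl, ← map_mul]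
    exact (mapNu_eq ι (nuMat_mul h a b c d)).symm
  · rw [mapNu_eq ι (x := ⟨_, nuMat_mem_borelH hq hF hω H⟩) rfl,
      mapDelta_eq hω ι (x := ⟨_, deltaHom_mem_borelH hω l⟩) rfl, ← map_inv, ← map_mul, ← map_mul]
    exact (mapNu_eq ι (nuMat_conj h a b l)).symm
  · obtain ⟨n, rfl⟩ := hω l
    have e : T * mapDelta hω ι ω ^ n * T⁻¹ = (T * mapDelta hω ι ω * T⁻¹) ^ n := conj_zpow.symm
    rw [hTi, hTD, ← map_zpow, ← map_zpow] at e
    simp only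
    rw [e, inv_zpow, ← zpow_natCast, ← zpow_natCast, zpow_comm]

/-- The one case with content is x T y T: write y = ν(a, b)Δ(l) and move Δ(l) past the last T. If b
= 0 then a = 0 and the two T cancel; otherwise P(a, b) replaces T ν(a, b) T by an element of HTH. -/
theorem bruhat_induction (hq : 2 < q) (hF : Nat.card F = q ^ 2)
    (hω : ∀ x : Fˣ, x ∈ Subgroup.zpowers ω) (ι : borelH q ω →* Γ) {T : Γ}
    (R : BorelRules q (mapNu ι) (mapDelta hω ι) T)
    (E : ∀ (a : F) (b : Fˣ), TraceCond q a (b : F) → PRel q (mapNu ι) (mapDelta hω ι) T a b)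
    (hgen : Subgroup.closure (Set.range ι ∪ {T}) = ⊤) (g : Γ) :
    (∃ x, g = ι x) ∨ ∃ x y, g = ι x * T * ι y := by
  have h := quadConj_of_card hq hF
  have hTi : T⁻¹ = T := inv_eq_of_mul_eq_one_right R.TT
  have mulι : ∀ (g : Γ) (z : borelH q ω), ((∃ x, g = ι x) ∨ ∃ x y, g = ι x * T * ι y) →
      (∃ x, g * ι z = ι x) ∨ ∃ x y, g * ι z = ι x * T * ι y := by
    rintro g z (⟨x, rfl⟩ | ⟨x, y, rfl⟩)
    · exact Or.inl ⟨x * z, by rw [map_mul]⟩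
    · exact Or.inr ⟨x, y * z, by rw [map_mul]; simp only [mul_assoc]⟩
  have mulT : ∀ g : Γ, ((∃ x, g = ι x) ∨ ∃ x y, g = ι x * T * ι y) →
      (∃ x, g * T = ι x) ∨ ∃ x y, g * T = ι x * T * ι y := by
    rintro g (⟨x, rfl⟩ | ⟨x, y, rfl⟩)
    · exact Or.inr ⟨x, 1, by rw [map_one, mul_one]⟩
    · obtain ⟨hy, hu⟩ := (mem_borelH_iff hq hF hω y).1 y.2
      obtain ⟨a, b, l, H, e⟩ := exists_eq_nuMat_mul_deltaHom h hy hu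
      obtain ⟨d, hd⟩ : ∃ d, mapDelta hω ι (l ^ q)⁻¹ = ι d := ⟨_, rfl⟩
      have e1 : ι y = mapNu ι a b * mapDelta hω ι l := by
        rw [mapNu_eq ι (x := ⟨_, nuMat_mem_borelH hq hF hω H⟩) rfl,
          mapDelta_eq hω ι (x := ⟨_, deltaHom_mem_borelH hω l⟩) rfl, ← map_mul]
        exact congrArg ι (Subtype.ext e)
      have e2 : ι x * T * ι y * T = ι x * (T * mapNu ι a b * T) * ι d := by
        rw [e1, ← hd, ← R.TD]
        simp only [mul_assoc]
        rw [← mul_assoc T T, R.TT, one_mul]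
      rw [e2]
      apply mulι
      rcases eq_or_ne b 0 with rfl | hb
      · have ha : a = 0 := by
          unfold TraceCond at H
          rw [h.zero, add_zero, eq_comm, neg_eq_zero, mul_eq_zero] at H
          exact H.elim id eq_zero_of_pow_eq_zero
        subst ha
        rw [mapNu_eq ι (x := 1) (nuMat_zero h).symm, map_one, mul_one, R.TT, mul_one]
        exact Or.inl ⟨x, rfl⟩
      · lift b to Fˣ using hb.isUnit
        have := E a b H
        unfold PRel at this
        rw [this, mapNu_eq ι (x := ⟨_, nuMat_mem_borelH hq hF hω (H.left h)⟩) rfl,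
          mapNu_eq ι (x := ⟨_, nuMat_mem_borelH hq hF hω (H.right h)⟩) rfl,
          mapDelta_eq hω ι (x := ⟨_, deltaHom_mem_borelH hω _⟩) rfl, ← map_mul, ← mul_assoc,
          ← mul_assoc, ← map_mul]
        exact Or.inr ⟨_, _, rfl⟩
  have hg : g ∈ Subgroup.closure (Set.range ι ∪ {T}) := hgen ▸ Subgroup.mem_top g
  induction hg using Subgroup.closure_induction_right with
  | one => exact Or.inl ⟨1, (map_one ι).symm⟩
  | mul_right g _ s hs ih =>
    rcases hs with ⟨z, rfl⟩ | rfl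
    · exact mulι g z ih
    · exact mulT g ih
  | mul_inv_cancel g _ s hs ih =>
    rcases hs with ⟨z, rfl⟩ | rfl
    · rw [← map_inv]
      exact mulι g _ ih
    · rw [hTi]
      exact mulT g ih

end Amalgam

/-- Conjugating twice by the involution gives x = x^(n²). This is why Δ^(q²-1) may be omitted from
the relators. -/
theorem pow_eq_one_of_conj {G : Type*} [Group G] {x t : G} {n : ℕ} (hn : 0 < n) (ht : t ^ 2 = 1)
    (hx : t⁻¹ * x * t = x ^ (-(n : ℤ))) : x ^ (n ^ 2 - 1) = 1 := by
  have h1 : t⁻¹ * x ^ (-(n : ℤ)) * t = (t⁻¹ * x * t) ^ (-(n : ℤ)) := by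
    have := conj_zpow (a := t⁻¹) (b := x) (i := -(n : ℤ))
    rw [inv_inv] at this
    exact this.symm
  have h2 : t⁻¹ * x ^ (-(n : ℤ)) * t = x := by
    rw [← hx]
    have ht' : t * t = 1 := by rw [← sq, ht]
    have hti : t⁻¹ = t := inv_eq_of_mul_eq_one_right ht'
    rw [hti]
    simp only [mul_assoc]
    rw [ht', mul_one, ← mul_assoc, ht', one_mul]
  rw [hx, ← zpow_mul, neg_mul_neg, h2] at h1
  have h3 : x ^ (n ^ 2) = x := by
    rw [sq, ← zpow_natCast]
    push_cast
    exact h1.symm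
  have h4 : n ^ 2 = n ^ 2 - 1 + 1 := (Nat.sub_add_cancel (Nat.one_le_pow 2 n hn)).symm
  rw [h4, pow_succ] at h3
  exact mul_eq_right.1 h3

/-! ### From all relations P(u) to the presentation. -/

section Presentation

variable {F : Type*} [Field F] {q : ℕ} {ω : Fˣ}

theorem lift_su3Gens_inclWord (w : FreeGroup (Fin 3)) :
    FreeGroup.lift (su3Gens q ω) (inclWord w) = evalH q ω w := by
  have : (FreeGroup.lift (su3Gens q ω)).comp inclWord = evalH q ω := by
    ext i
    fin_cases i <;> simp [inclWord, evalH, su3Gens, borelGens]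
  exact DFunLike.congr_fun this w

theorem eq_deltaHom_of_val_eq_diagonal (h : QuadConj F q) {A : SL3 F} {b : Fˣ}
    (hA : A.1 = Matrix.diagonal
      ![((b ^ (-(q : ℤ)) : Fˣ) : F), ((b ^ ((q : ℤ) - 1) : Fˣ) : F), (b : F)]) :
    A = deltaHom F q (b ^ q)⁻¹ := by
  apply Subtype.ext
  rw [hA, deltaHom_val]
  ext i j
  fin_cases i <;> fin_cases j <;> simp [h.pp, zpow_sub₀]
  field_simp

theorem lift_su3Gens_wT : FreeGroup.lift (su3Gens q ω) wT = tMat F := by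
  simp [wT, su3Gens]

theorem evalH_wDelta : evalH q ω wDelta = deltaHom F q ω := by
  simp [wDelta, evalH, borelGens]
  rfl

theorem evalH_mem (w : FreeGroup (Fin 3)) : evalH q ω w ∈ borelH q ω := by
  induction w using FreeGroup.induction_on with
  | C1 => exact map_one (evalH q ω) ▸ one_mem _
  | of i =>
    apply Subgroup.subset_closure
    fin_cases i <;> simp [evalH, borelGens]
  | inv_of i hi => exact map_inv (evalH q ω) _ ▸ inv_mem hi
  | mul x y hx hy => exact map_mul (evalH q ω) x y ▸ mul_mem hx hy

theorem evalH_of_presentation {R : Set (FreeGroup (Fin 3))}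
    (φ : PresentedGroup R ≃* borelH q ω)
    (hφ : ∀ i, (φ (PresentedGroup.of i) : SL3 F) = borelGens q ω i) (w : FreeGroup (Fin 3)) :
    (φ (PresentedGroup.mk R w) : SL3 F) = evalH q ω w := by
  have : ((borelH q ω).subtype.comp φ.toMonoidHom).comp (PresentedGroup.mk R) = evalH q ω := by
    ext i
    simpa [evalH, PresentedGroup.of] using
      congrFun (congrFun (congrArg (fun A : SL3 F => A.1) (hφ i)) _) _
  exact DFunLike.congr_fun this w

variable [Finite F]

/-- Reduces the theorem to a statement about arbitrary groups obeying `BorelRules`: the relations P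
on U₀ imply all of them. -/
theorem completes_of_pRel (hq : 2 < q) (hF : Nat.card F = q ^ 2)
    (hω : ∀ x : Fˣ, x ∈ Subgroup.zpowers ω) {U₀ : Set (SL3 F)}
    (hU : ∀ (Γ : Type) [Group Γ] (N : F → F → Γ) (D : Fˣ →* Γ) (T : Γ), BorelRules q N D T →
      (∀ (a : F) (b : Fˣ), nuMat q a (b : F) ∈ U₀ → PRel q N D T a b) →
      ∀ (a : F) (b : Fˣ), TraceCond q a (b : F) → PRel q N D T a b) :
    Completes q ω U₀ := by
  intro R₁ P hpres hP
  have h := quadConj_of_card hq hF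
  set S := R₁ ∪ {wDelta ^ (q ^ 2 - 1)} with hS
  obtain ⟨φ, hφ⟩ := hpres
  have hev := evalH_of_presentation φ hφ
  set Rel := su3Relators q R₁ (P '' U₀) with hRel
  set μ := PresentedGroup.mk Rel with hμ
  have hT2 : μ wT ^ 2 = 1 := by
    rw [← map_pow]
    exact PresentedGroup.one_of_mem (Or.inr (Or.inr rfl))
  have hTT : μ wT * μ wT = 1 := by rw [← sq, hT2]
  have hTi : (μ wT)⁻¹ = μ wT := inv_eq_of_mul_eq_one_right hTT
  have hΔ : (μ wT)⁻¹ * μ (inclWord wDelta) * μ wT = μ (inclWord wDelta) ^ (-(q : ℤ)) := by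
    have : μ ((wT⁻¹ * inclWord wDelta * wT) * (inclWord wDelta ^ (-(q : ℤ)))⁻¹) = 1 :=
      PresentedGroup.one_of_mem (Or.inr (Or.inl rfl))
    rw [map_mul, map_inv, mul_inv_eq_one] at this
    simpa using this
  have hS1 : ∀ r ∈ S, FreeGroup.lift (fun i : Fin 3 => (PresentedGroup.of i.castSucc :
      PresentedGroup Rel)) r = 1 := by
    have e : FreeGroup.lift (fun i : Fin 3 => (PresentedGroup.of i.castSucc :
        PresentedGroup Rel)) = μ.comp inclWord := by
      ext i
      simp [inclWord, PresentedGroup.of, hμ]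
    rw [e]
    rintro r (hr | rfl)
    · exact PresentedGroup.one_of_mem (Or.inl (Or.inl ⟨r, hr, rfl⟩))
    · simp only [MonoidHom.comp_apply, map_pow]
      exact pow_eq_one_of_conj (by omega) hT2 hΔ
  set ι : borelH q ω →* PresentedGroup Rel :=
    (PresentedGroup.toGroup hS1).comp φ.symm.toMonoidHom with hι
  have hιw : ∀ (w : FreeGroup (Fin 3)) (x : borelH q ω), (x : SL3 F) = evalH q ω w →
      ι x = μ (inclWord w) := by
    intro w x hx
    have e1 : x = φ (PresentedGroup.mk S w) := Subtype.ext (hx.trans (hev w).symm)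
    have e2 : (PresentedGroup.toGroup hS1).comp (PresentedGroup.mk S) = μ.comp inclWord := by
      ext i
      exact (PresentedGroup.toGroup.of hS1).trans (by simp [inclWord, PresentedGroup.of, hμ])
    rw [e1, hι]
    simpa using DFunLike.congr_fun e2 w
  have hDω : mapDelta hω ι ω = μ (inclWord wDelta) :=
    hιw wDelta ⟨_, deltaHom_mem_borelH hω ω⟩ evalH_wDelta.symm
  have R : BorelRules q (mapNu ι) (mapDelta hω ι) (μ wT) := by
    refine borelRules_map hq hF hω ι hTT ?_
    rw [hTi, zpow_neg, zpow_natCast] at hΔ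
    rw [map_inv, map_pow, hDω, hΔ]
  have E : ∀ (a : F) (b : Fˣ), TraceCond q a (b : F) →
      PRel q (mapNu ι) (mapDelta hω ι) (μ wT) a b := by
    refine hU _ _ _ _ R ?_
    intro a b hab
    obtain ⟨a', b', w, wL, wd, wR, e0, e1, e2, e3, e4, e5⟩ := hP _ hab
    obtain ⟨rfl, hb⟩ := nuMat_inj e0
    obtain rfl : b = b' := Units.ext hb
    have hr : μ (P (nuMat q a b)) = 1 :=
      PresentedGroup.one_of_mem (Or.inl (Or.inr ⟨_, hab, rfl⟩))
    rw [e5, map_mul, map_inv, mul_inv_eq_one] at hr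
    simp only [map_mul, map_inv, hTi] at hr
    have f3 := eq_deltaHom_of_val_eq_diagonal h e3
    have g1 : mapNu ι a b = μ (inclWord w) := by
      rw [mapNu_eq ι (x := ⟨_, evalH_mem w⟩) e1]
      exact hιw w _ rfl
    have g2 : mapNu ι (-(a / (b : F) ^ q)) (b : F)⁻¹ = μ (inclWord wL) := by
      rw [mapNu_eq ι (x := ⟨_, evalH_mem wL⟩) (e2.trans (by simp [div_eq_mul_inv]))]
      exact hιw wL _ rfl
    have g3 : mapNu ι (-(a / b)) (b : F)⁻¹ = μ (inclWord wR) := by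
      rw [mapNu_eq ι (x := ⟨_, evalH_mem wR⟩) (e4.trans (by simp [div_eq_mul_inv]))]
      exact hιw wR _ rfl
    have g4 : mapDelta hω ι (b ^ q)⁻¹ = μ (inclWord wd) := by
      rw [mapDelta_eq hω ι (x := ⟨_, evalH_mem wd⟩) f3]
      exact hιw wd _ rfl
    unfold PRel
    rw [g1, g2, g3, g4, hr]
  have hgen : Subgroup.closure (Set.range ι ∪ {μ wT}) = ⊤ := by
    rw [eq_top_iff, ← PresentedGroup.closure_range_of Rel, Subgroup.closure_le]
    rintro _ ⟨i, rfl⟩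
    apply Subgroup.subset_closure
    induction i using Fin.lastCases with
    | last => exact Or.inr rfl
    | cast i =>
      refine Or.inl ⟨⟨_, evalH_mem (FreeGroup.of i)⟩, ?_⟩
      rw [hιw (FreeGroup.of i) _ rfl]
      simp [inclWord, PresentedGroup.of, hμ]
  have hrel : ∀ r ∈ Rel, FreeGroup.lift (su3Gens q ω) r = 1 := by
    rintro r ((⟨r, hr, rfl⟩ | ⟨u, hu, rfl⟩) | rfl | rfl)
    · rw [lift_su3Gens_inclWord, ← hev r, PresentedGroup.one_of_mem (Or.inl hr), map_one]
      rfl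
    · obtain ⟨a, b, w, wL, wd, wR, e0, e1, e2, e3, e4, e5⟩ := hP _ hu
      have H : TraceCond q a (b : F) := by
        refine traceCond_of_mem_SU3 h ((mem_borelH_iff hq hF hω _).1 ?_).1
        rw [← e0, ← e1]
        exact evalH_mem w
      have f3 := eq_deltaHom_of_val_eq_diagonal h e3
      rw [e5]
      simp only [map_mul, map_inv, lift_su3Gens_inclWord, lift_su3Gens_wT, e1, e2, f3, e4, e0,
        tMat_inv]
      rw [tMat_conj_nu h H, mul_inv_eq_one]
      simp [div_eq_mul_inv]
    · rw [map_mul, map_inv, map_mul, map_mul, map_inv, map_zpow, lift_su3Gens_inclWord,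
        lift_su3Gens_wT, evalH_wDelta, tMat_inv, tMat_conj_delta h, mul_inv_eq_one]
      simp
    · rw [map_pow, lift_su3Gens_wT, sq, tMat_mul_self]
  set ρ : PresentedGroup Rel →* SL3 F := PresentedGroup.toGroup hrel with hρ
  have hρμ : ∀ w, ρ (μ w) = FreeGroup.lift (su3Gens q ω) w := fun w => rfl
  have hρT : ρ (μ wT) = tMat F := by rw [hρμ, lift_su3Gens_wT]
  -- The evaluation map retracts ι, so H embeds in the presented group.
  have hρι : ∀ x, ρ (ι x) = x := by
    intro x
    obtain ⟨y, rfl⟩ := φ.surjective x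
    obtain ⟨w, rfl⟩ := PresentedGroup.mk_surjective S y
    rw [hιw w _ (hev w), hρμ, lift_su3Gens_inclWord, hev]
  have hmem : ∀ g, ρ g ∈ SU3 F q := by
    intro g
    have hB : borelH q ω ≤ SU3 F q := fun x hx => ((mem_borelH_iff hq hF hω x).1 hx).1
    rcases bruhat_induction hq hF hω ι R E hgen g with ⟨x, rfl⟩ | ⟨x, y, rfl⟩
    · rw [hρι]
      exact hB x.2
    · rw [map_mul, map_mul, hρι, hρι, hρT]
      exact mul_mem (mul_mem (hB x.2) (tMat_mem_SU3 h)) (hB y.2)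
  have hinj : Function.Injective ρ := by
    rw [injective_iff_map_eq_one]
    intro g hg
    rcases bruhat_induction hq hF hω ι R E hgen g with ⟨x, rfl⟩ | ⟨x, y, rfl⟩
    · rw [hρι] at hg
      rw [show x = 1 from Subtype.ext hg, map_one]
    · exfalso
      rw [map_mul, map_mul, hρι, hρι, hρT] at hg
      -- A trivial image of an element x t y would place t in H.
      have ht : tMat F ∈ borelH q ω := by
        have : tMat F = (x : SL3 F)⁻¹ * (y : SL3 F)⁻¹ := by
          rw [eq_inv_mul_iff_mul_eq, eq_inv_iff_mul_eq_one]
          exact hg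
        rw [this]
        exact mul_mem (inv_mem x.2) (inv_mem y.2)
      have := ((mem_borelH_iff hq hF hω _).1 ht).2.2.1
      simp [tMat] at this
  have hsurj : Function.Surjective (ρ.codRestrict (SU3 F q) hmem) := by
    rintro ⟨A, hA⟩
    obtain ⟨g, hg⟩ : A ∈ ρ.range := by
      refine closure_su3Gens hq hF hω hA (fun x hx => ⟨ι ⟨x, hx⟩, hρι _⟩) ⟨_, hρT⟩
    exact ⟨g, Subtype.ext hg⟩
  refine ⟨MulEquiv.ofBijective (ρ.codRestrict (SU3 F q) hmem)
    ⟨fun x y hxy => hinj (congrArg Subtype.val hxy), hsurj⟩, fun i => ?_⟩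
  exact PresentedGroup.toGroup.of hrel

end Presentation

/-! ### Existence and sufficiency of the elements α_i and γ₀. -/

section Generators

variable {F : Type*} [Field F] {q : ℕ} {ω : Fˣ}

theorem omega_pow_ne (hq : 2 < q) (hF : Nat.card F = q ^ 2)
    (hω : ∀ x : Fˣ, x ∈ Subgroup.zpowers ω) : (ω : F) - (ω : F) ^ q ≠ 0 := by
  intro h0
  have := (zpow_fixed_iff hq hF hω 1).1 (by
    rw [zpow_one]
    exact Units.ext (by push_cast; exact (sub_eq_zero.1 h0).symm))
  have := Int.le_of_dvd one_pos this
  omega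

theorem beta_eq (h : QuadConj F q) {β₀ : F}
    (hβ₀ : β₀ = (ω : F) * zetaElt q ω ∨ β₀ = (ω : F) ^ (1 + (q ^ 2 + q) / 2)) :
    ∃ s : F, s ≠ 0 ∧ s ^ q = s ∧ β₀ = s * (ω * zetaElt q ω) := by
  rcases hβ₀ with rfl | rfl
  · exact ⟨1, one_ne_zero, one_pow q, (one_mul _).symm⟩
  · refine ⟨-1, neg_ne_zero.2 one_ne_zero, by rw [h.neg, one_pow], ?_⟩
    rw [zetaElt, pow_add]
    ring

theorem trq_fixed (h : QuadConj F q) (x : F) : trq q x ^ q = trq q x := by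
  rw [trq, h.add, h.pp, add_comm]

theorem traceCond_iff {a b : F} : TraceCond q a b ↔ a ^ (q + 1) = -trq q b := by
  rw [TraceCond, trq, pow_succ', eq_neg_iff_add_eq_zero, eq_neg_iff_add_eq_zero, add_comm]

theorem trq_beta [Finite F] (hq : 2 < q) (hF : Nat.card F = q ^ 2)
    (hω : ∀ x : Fˣ, x ∈ Subgroup.zpowers ω) {c : F} (hc : c ^ q = c) :
    trq q (c * (ω * zetaElt q ω)) = c * zetaElt q ω * (ω - (ω : F) ^ q) := by
  rw [trq, mul_pow, mul_pow, hc, zetaElt_pow hq hF hω]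
  ring

theorem trq_beta_ne_zero [Finite F] (hq : 2 < q) (hF : Nat.card F = q ^ 2)
    (hω : ∀ x : Fˣ, x ∈ Subgroup.zpowers ω) {c : F} (hc : c ^ q = c) (hc0 : c ≠ 0) :
    trq q (c * (ω * zetaElt q ω)) ≠ 0 := by
  rw [trq_beta hq hF hω hc]
  exact mul_ne_zero (mul_ne_zero hc0 zetaElt_ne_zero) (omega_pow_ne hq hF hω)

theorem exists_gamma [Finite F] (hq : 2 < q) (hF : Nat.card F = q ^ 2)
    (hω : ∀ x : Fˣ, x ∈ Subgroup.zpowers ω) {s : F} (hs : s ^ q = s) (hs0 : s ≠ 0) :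
    ∃ γ₀ : F, trq q γ₀ = 0 ∧ ∃ c : F, c ≠ 0 ∧ c ^ q = c ∧
      s * (ω * zetaElt q ω) + γ₀ = c * ((ω : F)⁻¹ * zetaElt q ω) := by
  have h := quadConj_of_card hq hF
  have hw : (ω : F) ≠ 0 := ω.ne_zero
  have hW : (ω : F) ^ q ≠ 0 := pow_ne_zero q hw
  have hζq := zetaElt_pow hq hF hω
  have hcq : (-(s * (ω * (ω : F) ^ q))) ^ q = -(s * (ω * (ω : F) ^ q)) := by
    rw [h.neg, mul_pow, mul_pow, h.pp, hs]
    ring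
  -- With c = -s ω^(q+1), the elements c ω⁻¹ζ and s ωζ have the same trace; γ₀ is their difference.
  refine ⟨-(s * (ω * (ω : F) ^ q)) * ((ω : F)⁻¹ * zetaElt q ω) - s * (ω * zetaElt q ω), ?_,
    -(s * (ω * (ω : F) ^ q)), ?_, hcq, by ring⟩
  · rw [trq, h.sub, mul_pow, hcq, mul_pow, mul_pow, mul_pow, hζq, hs, inv_pow]
    field_simp
    ring
  · exact neg_ne_zero.2 (mul_ne_zero hs0 (mul_ne_zero hw hW))

/-- Otherwise ω² would lie in GF(q), so q + 1 would divide 2. -/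
theorem gamma_ne_zero (hq : 2 < q) (hF : Nat.card F = q ^ 2)
    (hω : ∀ x : Fˣ, x ∈ Subgroup.zpowers ω) {s c γ₀ : F} (hs : s ^ q = s) (hs0 : s ≠ 0)
    (hc : c ^ q = c)
    (e : s * (ω * zetaElt q ω) + γ₀ = c * ((ω : F)⁻¹ * zetaElt q ω)) : γ₀ ≠ 0 := by
  rintro rfl
  have hw : (ω : F) ≠ 0 := ω.ne_zero
  have hζ := zetaElt_ne_zero (q := q) (ω := ω)
  have e2 : (ω : F) ^ 2 = c / s := by
    rw [add_zero] at e
    field_simp at e ⊢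
    linear_combination e
  have h3 := (zpow_fixed_iff hq hF hω (2 : ℕ)).1 (by
    rw [zpow_natCast]
    exact Units.ext (by push_cast; rw [e2, div_pow, hc, hs]))
  have := Int.le_of_dvd (by norm_num) h3
  omega

/-- Covers both residues of q mod 3: all that is needed of U₀ is τ₀ and elements ν(a₀, β₀) whose a₀
meet every coset of the (q-2)-th powers. -/
theorem completes_of_mem [Finite F] (hq : 2 < q) (hF : Nat.card F = q ^ 2)
    (hω : ∀ x : Fˣ, x ∈ Subgroup.zpowers ω) {s γ₀ : F} (hs : s ^ q = s) (hs0 : s ≠ 0)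
    (hγ : trq q γ₀ = 0) (hγ0 : γ₀ ≠ 0) {U₀ : Set (SL3 F)} (hγU : nuMat q 0 γ₀ ∈ U₀)
    (hα : ∀ x : Fˣ, ∃ a₀ : F, a₀ ≠ 0 ∧ TraceCond q a₀ (s * (ω * zetaElt q ω)) ∧
      nuMat q a₀ (s * (ω * zetaElt q ω)) ∈ U₀ ∧ ∃ l : Fˣ, (l : F) ^ q / (l : F) ^ 2 = x / a₀) :
    Completes q ω U₀ := by
  have h := quadConj_of_card hq hF
  refine completes_of_pRel hq hF hω fun Γ _ N D T R hP a b H => ?_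
  refine pRel_all h hF hω R (fun c hc => ?_) (fun a b c H hc hb => ?_) H
  · refine PRel.central h hF hω R (c₀ := Units.mk0 γ₀ hγ0) ?_ hc (hP 0 (Units.mk0 γ₀ hγ0) hγU)
    rw [Units.val_mk0]
    exact eq_neg_of_add_eq_zero_right hγ
  · have hc0 : c ≠ 0 := by
      rintro rfl
      exact b.ne_zero (by rw [hb, zero_mul])
    have ha : a ≠ 0 := by
      rintro rfl
      apply trq_beta_ne_zero hq hF hω hc hc0
      rw [traceCond_iff, hb, zero_pow q.succ_ne_zero] at H
      exact neg_eq_zero.1 H.symm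
    obtain ⟨a₀, ha₀, H₀, hU, l, hl⟩ := hα (Units.mk0 a ha)
    have hβ : s * (ω * zetaElt q ω) ≠ 0 :=
      mul_ne_zero hs0 (mul_ne_zero ω.ne_zero zetaElt_ne_zero)
    refine PRel.conj_of_div h R (b₀ := Units.mk0 _ hβ) H₀ H (hP a₀ (Units.mk0 _ hβ) hU) ha₀
      (c := c / s) (by rw [div_pow, hc, hs]) ?_ hl
    rw [hb, Units.val_mk0]
    field_simp

theorem exists_traceCond [Finite F] (hq : 2 < q) (hF : Nat.card F = q ^ 2)
    (hω : ∀ x : Fˣ, x ∈ Subgroup.zpowers ω) {b : F} (hb : trq q b ≠ 0) :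
    ∃ l : Fˣ, (l : F) ^ (q + 1) = -trq q b := by
  have h := quadConj_of_card hq hF
  obtain ⟨l, hl⟩ := exists_mul_pow_eq hq hF hω (neg_ne_zero.2 hb) (by rw [h.neg, trq_fixed h])
  exact ⟨l, by rw [pow_succ', hl]⟩

theorem exists_traceCond_cube [Finite F] (hq : 2 < q) (hF : Nat.card F = q ^ 2)
    (hω : ∀ x : Fˣ, x ∈ Subgroup.zpowers ω) (h3 : q ≡ 2 [MOD 3]) {b : F} (hb : trq q b ≠ 0)
    (i : ℕ) : ∃ a : F, a ^ (q + 1) = -trq q b ∧ ∃ c : Fˣ, a = (ω : F) ^ i * (c : F) ^ 3 := by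
  have h := quadConj_of_card hq hF
  obtain ⟨l, hl⟩ := exists_traceCond hq hF hω hb
  obtain ⟨n, rfl⟩ := hω l
  obtain ⟨k, hk⟩ : ∃ k, q = 3 * k + 2 := ⟨q / 3, by unfold Nat.ModEq at h3; omega⟩
  -- Multiplying ω^n by the norm-1 element ω^((i-n)(q-1)) keeps the norm. As q - 1 = 3k + 1, the
  -- exponent becomes i modulo 3.
  have e : ω ^ n * ((ω ^ (i - n : ℤ)) ^ q / ω ^ (i - n : ℤ)) =
      ω ^ i * (ω ^ ((i - n : ℤ) * k)) ^ 3 := by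
    rw [← zpow_natCast, ← zpow_natCast, ← zpow_natCast, ← zpow_mul, ← zpow_mul, div_eq_mul_inv,
      ← zpow_sub,
      ← zpow_add, ← zpow_add, hk]
    congr 1
    push_cast
    ring
  refine ⟨((ω ^ n * ((ω ^ (i - n : ℤ)) ^ q / ω ^ (i - n : ℤ)) : Fˣ) : F), ?_,
    ω ^ ((i - n : ℤ) * k), ?_⟩
  · rw [← hl, ← Units.val_pow_eq_pow_val, ← Units.val_pow_eq_pow_val]
    congr 1
    rw [mul_pow, pow_succ (_ / _), div_pow, h.unit_pp, div_mul_div_cancel, div_self', mul_one]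
  · rw [e]
    push_cast
    rfl

/-- For q ≡ 2 mod 3 the order q² - 1 of ω is divisible by 3, so 1, ω, ω² lie in distinct cosets of
the cubes. -/
theorem cube_classes_injective (hF : Nat.card F = q ^ 2)
    (hω : ∀ x : Fˣ, x ∈ Subgroup.zpowers ω) (hq : 2 < q) (h3 : q ≡ 2 [MOD 3]) {α : Fin 3 → F}
    (hα : ∀ i : Fin 3, ∃ c : Fˣ, α i = (ω : F) ^ (i : ℕ) * (c : F) ^ 3) :
    Function.Injective α := by
  intro i j hij
  obtain ⟨c, hc⟩ := hα i
  obtain ⟨d, hd⟩ := hα j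
  have e : ω ^ (i : ℕ) * c ^ 3 = ω ^ (j : ℕ) * d ^ 3 :=
    Units.ext (by push_cast; rw [← hc, ← hd, hij])
  obtain ⟨m, rfl⟩ := hω c
  obtain ⟨n, rfl⟩ := hω d
  simp only at e
  rw [← zpow_natCast, ← zpow_natCast, ← zpow_natCast, ← zpow_natCast, ← zpow_mul, ← zpow_mul,
    ← zpow_add, ← zpow_add, zpow_eq_zpow_iff_modEq, orderOf_primitive hF hω] at e
  obtain ⟨k, hk⟩ : ∃ k, q = 3 * k + 2 := ⟨q / 3, by unfold Nat.ModEq at h3; omega⟩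
  have h4 : (3 : ℤ) ∣ ((q ^ 2 - 1 : ℕ) : ℤ) := by
    rw [Nat.cast_sub (Nat.one_le_pow _ _ (by omega)), hk]
    exact ⟨3 * k ^ 2 + 4 * k + 1, by push_cast; ring⟩
  have h5 := (e.of_dvd h4)
  rw [Int.ModEq] at h5
  push_cast at h5
  apply Fin.ext
  omega

theorem cube_classes_cover (h : QuadConj F q) (hω : ∀ x : Fˣ, x ∈ Subgroup.zpowers ω)
    {α : Fin 3 → F} (hα : ∀ i : Fin 3, ∃ c : Fˣ, α i = (ω : F) ^ (i : ℕ) * (c : F) ^ 3) (x : Fˣ) :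
    ∃ (i : Fin 3) (l : Fˣ), (l : F) ^ q / (l : F) ^ 2 = x / α i := by
  obtain ⟨n, rfl⟩ := hω x
  obtain ⟨k, hk⟩ := Int.eq_ofNat_of_zero_le (Int.emod_nonneg n three_ne_zero)
  have hk3 : k < 3 := by omega
  obtain ⟨c, hc⟩ := hα ⟨k, hk3⟩
  -- The index k = n mod 3 makes ω^n/α_k the cube of ω^(n/3)/c (integer quotient), and every cube is
  -- a (q-2)-th power.
  obtain ⟨l, hl⟩ := cube_eq_div h (ω ^ (n / 3) / c)
  refine ⟨⟨k, hk3⟩, l, ?_⟩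
  have e : ω ^ n / (ω ^ k * c ^ 3) = l ^ q / l ^ 2 := by
    rw [hl, div_pow, ← div_div]
    congr 1
    have hn : n = 3 * (n / 3) + k := by omega
    rw [← zpow_natCast, ← zpow_natCast, ← zpow_mul, div_eq_mul_inv, ← zpow_sub]
    congr 1
    push_cast
    omega
  have e' := congrArg Units.val e
  push_cast at e'
  rw [hc, ← e']
  push_cast
  rfl

end Generators

/-! ### Counting U₀ and the final theorem. -/

theorem ncard_seven_of_injective {X : Type*} {f g : Fin 3 → X} {y : X}
    (hf : Function.Injective f) (hg : Function.Injective g) (hfy : ∀ i, f i ≠ y)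
    (hgy : ∀ i, g i ≠ y) (hfg : ∀ i j, f i ≠ g j) :
    (Set.range f ∪ {y} ∪ Set.range g).ncard = 7 := by
  have h1 : ∀ {k : Fin 3 → X}, Function.Injective k → (Set.range k).ncard = 3 := fun {k} hk => by
    rw [← Set.image_univ, Set.ncard_image_of_injective _ hk, Set.ncard_univ, Nat.card_fin]
  rw [Set.ncard_union_eq, Set.ncard_union_eq, h1 hf, h1 hg, Set.ncard_singleton]
  · rw [Set.disjoint_singleton_right]
    rintro ⟨i, hi⟩
    exact hfy i hi
  · rw [Set.disjoint_left]
    rintro _ (⟨i, rfl⟩ | rfl) ⟨j, hj⟩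
    · exact hfg i j hj.symm
    · exact hgy j hj

theorem mainTheorem10 {F : Type*} [Field F] [Finite F] (q : ℕ) (hq : 2 < q)
    (hF : Nat.card F = q ^ 2)
    (ω : Fˣ) (hω : ∀ x : Fˣ, x ∈ Subgroup.zpowers ω)
    (β₀ : F)
    (hβ₀ : β₀ = (ω : F) * zetaElt q ω ∨ β₀ = (ω : F) ^ (1 + (q ^ 2 + q) / 2)) :
    -- `H` is the Borel subgroup of upper triangular matrices in `SU(3, q)`
    (∀ A : SL3 F, A ∈ borelH q ω ↔
      A ∈ SU3 F q ∧ A.1 1 0 = 0 ∧ A.1 2 0 = 0 ∧ A.1 2 1 = 0) ∧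
    -- the element `γ₀` exists
    (∃ γ₀ : F, trq q γ₀ = 0 ∧
      ∃ c : F, c ≠ 0 ∧ c ^ q = c ∧ β₀ + γ₀ = c * ((ω : F)⁻¹ * zetaElt q ω)) ∧
    -- the case `q ≢ 2 mod 3`
    (¬ q ≡ 2 [MOD 3] →
      (∃ α₀ : F, α₀ ^ (q + 1) = -trq q β₀) ∧
      ∀ α₀ γ₀ : F, α₀ ^ (q + 1) = -trq q β₀ → trq q γ₀ = 0 →
        (∃ c : F, c ≠ 0 ∧ c ^ q = c ∧ β₀ + γ₀ = c * ((ω : F)⁻¹ * zetaElt q ω)) →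
        ∀ U₀ : Set (SL3 F),
          U₀ = {nuMat q α₀ β₀, nuMat q 0 γ₀, nuMat q α₀ β₀ * nuMat q 0 γ₀} →
          U₀.ncard = 3 ∧ Completes q ω U₀) ∧
    -- the case `q ≡ 2 mod 3`
    (q ≡ 2 [MOD 3] →
      (∃ α : Fin 3 → F, ∀ i : Fin 3,
        α i ^ (q + 1) = -trq q β₀ ∧ ∃ c : Fˣ, α i = (ω : F) ^ (i : ℕ) * (c : F) ^ 3) ∧
      ∀ (α : Fin 3 → F) (γ₀ : F),
        (∀ i : Fin 3, α i ^ (q + 1) = -trq q β₀ ∧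
          ∃ c : Fˣ, α i = (ω : F) ^ (i : ℕ) * (c : F) ^ 3) →
        trq q γ₀ = 0 →
        (∃ c : F, c ≠ 0 ∧ c ^ q = c ∧ β₀ + γ₀ = c * ((ω : F)⁻¹ * zetaElt q ω)) →
        ∀ U₀ : Set (SL3 F),
          U₀ = Set.range (fun i : Fin 3 => nuMat q (α i) β₀) ∪ {nuMat q 0 γ₀} ∪
            Set.range (fun i : Fin 3 => nuMat q (α i) β₀ * nuMat q 0 γ₀) →
          U₀.ncard = 7 ∧ Completes q ω U₀) := by
  have h := quadConj_of_card hq hF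
  obtain ⟨s, hs0, hs, rfl⟩ := beta_eq h hβ₀
  have htr := trq_beta_ne_zero hq hF hω hs hs0
  have hα0 : ∀ a : F, a ^ (q + 1) = -trq q (s * (ω * zetaElt q ω)) → a ≠ 0 := by
    rintro a ha rfl
    rw [zero_pow q.succ_ne_zero] at ha
    exact htr (neg_eq_zero.1 ha.symm)
  have hmul : ∀ a b γ : F, nuMat q a b * nuMat q 0 γ = nuMat q a (b + γ) := fun a b γ => by
    rw [nuMat_mul h, h.zero, mul_zero, add_zero, sub_zero]
  refine ⟨fun A => mem_borelH_iff hq hF hω A, exists_gamma hq hF hω hs hs0, fun h3 => ⟨?_, ?_⟩,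
    fun h3 => ⟨?_, ?_⟩⟩
  · obtain ⟨l, hl⟩ := exists_traceCond hq hF hω htr
    exact ⟨l, hl⟩
  · rintro α₀ γ₀ hα hγ ⟨c, -, hcq, hc⟩ U₀ rfl
    have hγ0 := gamma_ne_zero hq hF hω hs hs0 hcq hc
    have ha := hα0 α₀ hα
    refine ⟨Set.ncard_eq_three.2 ⟨_, _, _, fun e => ha (nuMat_inj e).1, fun e => hγ0 ?_,
      fun e => ha ?_, rfl⟩, ?_⟩
    · rw [hmul] at e
      exact left_eq_add.1 (nuMat_inj e).2
    · rw [hmul] at e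
      exact (nuMat_inj e).1.symm
    · refine completes_of_mem hq hF hω hs hs0 hγ hγ0 (by simp) fun x =>
        ⟨α₀, ha, traceCond_iff.2 hα, by simp, ?_⟩
      obtain ⟨l, hl⟩ := eq_div_of_not_modEq h h3 (x / Units.mk0 α₀ ha)
      exact ⟨l, by simpa using congrArg Units.val hl⟩
  · choose α hα using fun i : Fin 3 => exists_traceCond_cube hq hF hω h3 htr i
    exact ⟨α, hα⟩
  · rintro α γ₀ hα hγ ⟨c, -, hcq, hc⟩ U₀ rfl
    have hγ0 := gamma_ne_zero hq hF hω hs hs0 hcq hc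
    have ha : ∀ i, α i ≠ 0 := fun i => hα0 _ (hα i).1
    have hinj := cube_classes_injective hF hω hq h3 fun i => (hα i).2
    refine ⟨ncard_seven_of_injective (fun i j e => hinj (nuMat_inj e).1)
      (fun i j e => hinj (nuMat_inj (mul_right_cancel e)).1) (fun i e => ha i (nuMat_inj e).1)
      (fun i e => ha i ?_) (fun i j e => hγ0 ?_), ?_⟩
    · rw [hmul] at e
      exact (nuMat_inj e).1
    · rw [hmul] at e
      exact left_eq_add.1 (nuMat_inj e).2
    · refine completes_of_mem hq hF hω hs hs0 hγ hγ0 (Or.inl (Or.inr rfl)) fun x => ?_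
      obtain ⟨i, l, hl⟩ := cube_classes_cover h hω (fun i => (hα i).2) x
      exact ⟨α i, ha i, traceCond_iff.2 (hα i).1, Or.inl (Or.inl ⟨i, rfl⟩), l, hl⟩
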